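/- **Setting.** Let $D,k\ge 1$ be integers, let $\{|E_j\rangle\}_{j=1}^D$ be an orthonormal basis of $\mathbb{C}^D$ and $|\Psi_0\rangle\in\mathbb{C}^D$ a unit vector. An ensemble $\mathcal{E}$ of pure states is a probability distribution on unit vectors of $\mathbb{C}^D$; its $k$-th moment is $\rho^{(k)}_{\mathcal{E}}=\mathbb{E}_{\psi\sim\mathcal{E}}(|\psi\rangle\langle\psi|)^{\otimes k}$. For a density matrix $\sigma$ on $\mathbb{C}^D$, $\mathrm{Scrooge}(\sigma)$ is the ensemble of the states $\sqrt{\sigma}|\phi\rangle/\|\sqrt{\sigma}|\phi\rangle\|$ with $|\phi\rangle$ distributed according to $D\langle\phi|\sigma|\phi\rangle\,\mathrm{d}\phi$, where $\mathrm{d}\phi$ is the uniform (Haar) probability measure on the unit sphere of $\mathbb{C}^D$. An ensemble $\mathcal{E}$ is a $\mathrm{Scrooge}(\sigma)$ $k$-design with additive error $\epsilon$ if $\frac12\|\rho^{(k)}_{\mathcal{E}}-\rho^{(k)}_{\mathrm{Scrooge}(\sigma)}\|_1\le\epsilon$; here $\|\cdot\|_p$ is the Schatten $p$-norm. Put $$\sigma_{\mathrm{diag}}=\sum_{j=1}^D|\langle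 E_j|\Psi_0\rangle|^2\,|E_j\rangle\langle E_j|,\qquad \epsilon_0=\big(D\|\sigma_{\mathrm{diag}}\|_\infty\big)^k\,\frac{k^2}{D}+k\,\|\sigma_{\mathrm{diag}}\|_2 .$$ The random phase ensemble consists of the states $\sum_{j=1}^D|\langle E_j|\Psi_0\rangle|e^{i\varphi_j}|E_j\rangle$ with $\varphi=(\varphi_1,\dots,\varphi_D)$ uniformly distributed on $[0,2\pi)^D$. For a Hermitian $H$ with $H|E_j\rangle=e_j|E_j\rangle$, the temporal ensemble over $[0,T]$ consists of the states $e^{-iHt}|\Psi_0\rangle$ with $t$ uniformly distributed on $[0,T]$. The $H$-spectrum satisfies the $k$-th no-resonance condition if, for all indices $a_1,\dots,a_k,b_1,\dots,b_k\in\{1,\dots,D\}$ (repetitions allowed), $\sum_i e_{a_i}=\sum_i e_{b_i}$ if and only if $(b_i)$ is a reordering of $(a_i)$. **Theorem.** There is an absolute constant $C>0$ such that, for all $D,k,\{|E_j\rangle\},|\Psi_0\rangle$ as above with $k^2\|\sigma_{\mathrm{diag}}\|_2\le 1$: 1. the random phase ensemble is a $\mathrm{Scrooge}(\sigma_{\mathrm{diag}})$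 $k$-design with additive error $C\epsilon_0$; 2. for every Hermitian $H$ with eigenbasis $\{|E_j\rangle\}$ whose spectrum satisfies the $k$-th no-resonance condition, the temporal ensemble over $[0,T]$ is, for all sufficiently large $T$ (depending on $H$, $|\Psi_0\rangle$ and $k$), a $\mathrm{Scrooge}(\sigma_{\mathrm{diag}})$ $k$-design with additive error $C\epsilon_0$. Moreover, for every such $H$ satisfying the $k$-th no-resonance condition (and without any condition on $\|\sigma_{\mathrm{diag}}\|_2$), the $k$-th moment of the temporal ensemble over $[0,T]$ converges, as $T\to\infty$, to the $k$-th moment of the random phase ensemble. -/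

import Mathlib

open MeasureTheory ProbabilityTheory Filter Topology
open scoped Matrix ENNReal

noncomputable section

namespace Scrooge

/-- The Hilbert space `ℂ^D` with its Euclidean norm. -/
abbrev Hilb (D : ℕ) : Type := EuclideanSpace ℂ (Fin D)

/-- The action of a `D × D` matrix, as an operator on `ℂ^D`. -/
def act {D : ℕ} (A : Matrix (Fin D) (Fin D) ℂ) (ψ : Hilb D) : Hilb D :=
  Matrix.toEuclideanCLM (𝕜 := ℂ) A ψ

/-! ### Schatten norms -/

/-- The Schatten 1-norm: the sum of the singular values, that is, of the square roots of the
eigenvalues of `Aᴴ A`. -/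
def schattenOne {ι : Type*} [Fintype ι] [DecidableEq ι] (A : Matrix ι ι ℂ) : ℝ :=
  ∑ i, Real.sqrt ((Matrix.isHermitian_conjTranspose_mul_self A).eigenvalues i)

/-- The Schatten 2-norm (Hilbert-Schmidt norm) `√(Tr (Aᴴ A))`. -/
def schattenTwo {ι : Type*} [Fintype ι] (A : Matrix ι ι ℂ) : ℝ :=
  Real.sqrt (Matrix.trace (Aᴴ * A)).re

/-- The Schatten ∞-norm: the operator norm with respect to the Euclidean norm. -/
def schattenInf {ι : Type*} [Fintype ι] [DecidableEq ι] (A : Matrix ι ι ℂ) : ℝ :=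
  ‖Matrix.toEuclideanCLM (𝕜 := ℂ) A‖

/-! ### Ensembles of pure states

An ensemble of states on `ℂ^D` is given by the distribution of the state vector. -/

/-- `μ` is an ensemble of pure states: a probability distribution on unit vectors. -/
structure IsPureStateEnsemble {D : ℕ} (μ : Measure (Hilb D)) : Prop where
  isProbabilityMeasure : IsProbabilityMeasure μ
  norm_eq_one : ∀ᵐ ψ ∂μ, ‖ψ‖ = 1

/-- The `k`-fold tensor power `(|ψ⟩⟨ψ|)^{⊗ k}`, as a matrix in the product basis of
`(ℂ^D)^{⊗ k}`, which is indexed by `Fin k → Fin D`. -/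
def projPow {D : ℕ} (k : ℕ) (ψ : Hilb D) : Matrix (Fin k → Fin D) (Fin k → Fin D) ℂ :=
  Matrix.of fun x y => ∏ i, (ψ (x i) * star (ψ (y i)))

/-- The `k`-th moment operator `E_{ψ ∼ μ} (|ψ⟩⟨ψ|)^{⊗ k}` (entrywise expectation). -/
def moment {D : ℕ} (k : ℕ) (μ : Measure (Hilb D)) :
    Matrix (Fin k → Fin D) (Fin k → Fin D) ℂ :=
  Matrix.of fun x y => ∫ ψ, projPow k ψ x y ∂μ

/-! ### The Haar and the Scrooge ensemble -/

/-- Lebesgue measure on `ℂ^D`. -/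
def lebesgue (D : ℕ) : Measure (Hilb D) :=
  (volume : Measure (Fin D → ℂ)).map (WithLp.toLp 2)

/-- The uniform (Haar) probability measure on the unit sphere of `ℂ^D`: normalized surface
measure, as a measure on `ℂ^D`. -/
def haarState (D : ℕ) : Measure (Hilb D) :=
  (((lebesgue D).toSphere Set.univ)⁻¹ • (lebesgue D).toSphere).map Subtype.val

/-- The ensemble `Scrooge(σ)` of a density matrix `σ`: the states `√σ φ / ‖√σ φ‖`, with `φ`
distributed with density `D ⟨φ|σ|φ⟩` with respect to the Haar measure on the unit sphere. -/
def scrooge {D : ℕ} (σ : Matrix (Fin D) (Fin D) ℂ) : Measure (Hilb D) :=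
  ((haarState D).withDensity
      (fun φ => ENNReal.ofReal ((D : ℝ) * (inner ℂ φ (act σ φ)).re))).map
    (fun φ => ((‖act (cfc Real.sqrt σ) φ‖⁻¹ : ℝ) : ℂ) • act (cfc Real.sqrt σ) φ)

/-- `μ` is a `Scrooge(σ)` `k`-design with additive error `ε`. -/
def IsScroogeDesign {D : ℕ} (σ : Matrix (Fin D) (Fin D) ℂ) (k : ℕ) (ε : ℝ)
    (μ : Measure (Hilb D)) : Prop :=
  IsPureStateEnsemble μ ∧
    (1 / 2 : ℝ) * schattenOne (moment k μ - moment k (scrooge σ)) ≤ ε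

/-! ### The random phase ensemble and the temporal ensemble -/

/-- The diagonal state `∑ⱼ |⟨Eⱼ|Ψ₀⟩|² |Eⱼ⟩⟨Eⱼ|`. -/
def sigmaDiag {D : ℕ} (E : OrthonormalBasis (Fin D) ℂ (Hilb D)) (Ψ₀ : Hilb D) :
    Matrix (Fin D) (Fin D) ℂ :=
  ∑ j, ((‖inner ℂ (E j) Ψ₀‖ ^ 2 : ℝ) : ℂ) • Matrix.vecMulVec (E j).ofLp (star (E j).ofLp)

/-- The state `∑ⱼ |⟨Eⱼ|Ψ₀⟩| e^{i φⱼ} |Eⱼ⟩`. -/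
def phaseState {D : ℕ} (E : OrthonormalBasis (Fin D) ℂ (Hilb D)) (Ψ₀ : Hilb D)
    (φ : Fin D → ℝ) : Hilb D :=
  ∑ j, ((‖inner ℂ (E j) Ψ₀‖ : ℂ) * Complex.exp (Complex.I * (φ j : ℂ))) • E j

/-- The random phase ensemble: `phaseState` for independent phases that are uniformly
distributed on `[0, 2π)`. -/
def randomPhase {D : ℕ} (E : OrthonormalBasis (Fin D) ℂ (Hilb D)) (Ψ₀ : Hilb D) :
    Measure (Hilb D) :=
  (Measure.pi fun _ : Fin D => (volume : Measure ℝ)[|Set.Ico 0 (2 * Real.pi)]).map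
    (phaseState E Ψ₀)

/-- The evolved state `e^{-iHt} Ψ₀`. -/
def evolve {D : ℕ} (H : Matrix (Fin D) (Fin D) ℂ) (Ψ₀ : Hilb D) (t : ℝ) : Hilb D :=
  act (NormedSpace.exp ((-(Complex.I * (t : ℂ))) • H)) Ψ₀

/-- The temporal ensemble: `e^{-iHt} Ψ₀` for `t` uniformly distributed on `[0, T]`. -/
def temporal {D : ℕ} (H : Matrix (Fin D) (Fin D) ℂ) (Ψ₀ : Hilb D) (T : ℝ) :
    Measure (Hilb D) :=
  ((volume : Measure ℝ)[|Set.Icc 0 T]).map (evolve H Ψ₀)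

/-- `H` is Hermitian, with orthonormal eigenbasis `E` and energy levels `e`. -/
structure IsEigensystem {D : ℕ} (H : Matrix (Fin D) (Fin D) ℂ)
    (E : OrthonormalBasis (Fin D) ℂ (Hilb D)) (e : Fin D → ℝ) : Prop where
  isHermitian : H.IsHermitian
  eigen : ∀ j, act H (E j) = (e j : ℂ) • E j

/-- The `k`-th no-resonance condition: two families of `k` energy levels (labelled by the
eigenstates, repetitions allowed) have equal sums iff they agree up to reordering. -/
def NoResonance {D : ℕ} (k : ℕ) (e : Fin D → ℝ) : Prop :=
  ∀ a b : Fin k → Fin D,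
    (∑ i, e (a i) = ∑ i, e (b i)) ↔ ∃ π : Equiv.Perm (Fin k), ∀ i, b i = a (π i)

end Scrooge

end

/-!
Write `pⱼ = |⟨Eⱼ|Ψ₀⟩|²` for the eigenvalues of the diagonal state. In the product basis of `E`, which
is indexed by words `x : Fin k → Fin D`, the `k`-th moments of the random phase ensemble and of the
Scrooge ensemble have the same shape: averaging over phases kills every matrix element `(x, y)` unless
`x` and `y` have equal occupation numbers (`occ`), and on each block of words with given occupation
numbers the matrix is constant. It equals `∏ᵢ p (x i)` for random phases (`coeffMoment_randomPhase`)
and `scroogeDiag p x` for the Scrooge ensemble (`coeffMoment_scrooge`). A constant block has rank one,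
so the trace norm of the difference is at most `∑ₓ |∏ᵢ p (x i) - scroogeDiag p x|`
(`schattenOne_le_sum_abs_of_blocks`), the `ℓ¹` distance of two probability distributions on words.

Both distributions have total mass one, so only a lower bound on `scroogeDiag p x` is needed. With
`q = ∑ⱼ pⱼ |φⱼ|²` it is the Haar average of `D q · ∏ᵢ p (x i) |φ (x i)|² / qᵏ`, and the convexity of
`u ↦ u ^ (1 - k)` at the mean value `u = D q = 1` bounds this from below by a polynomial in `|φⱼ|²`
(`le_tilt_mul_prod`). The Haar moments of that polynomial are explicit (`integral_haarState_monomial`,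
from the Gaussian integral in polar coordinates), whence
`∏ᵢ p (x i) - scroogeDiag p x ≤ (∏ᵢ p (x i)) (k² / D + (k - 1) ∑ᵢ p (x i))`
(`prod_sub_scroogeDiag_le`). Summing over `x` gives `k² / D + k² ∑ⱼ pⱼ²`, which is at most the claimed
error because `D ‖σ‖_∞ ≥ 1` and `k² ‖σ‖₂ ≤ 1`.

For the temporal ensemble, the matrix element `(x, y)` oscillates with the frequency
`∑ᵢ e (y i) - ∑ᵢ e (x i)`. By the no-resonance condition this vanishes exactly when the occupation
numbers agree, so the time average converges to the random phase moment (`tendsto_moment_temporal`).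
The triangle inequality for the trace norm (`schattenOne_add_le`) then transfers the design property
to large finite `T`.
-/

namespace Scrooge

/-! ### The Schatten 1-norm and rank-one decompositions -/

section SchattenOne

variable {ι : Type*} [Fintype ι] [DecidableEq ι]

lemma inner_toEuclideanCLM_toEuclideanCLM (A : Matrix ι ι ℂ) (u v : EuclideanSpace ℂ ι) :
    inner ℂ (Matrix.toEuclideanCLM (𝕜 := ℂ) A u) (Matrix.toEuclideanCLM (𝕜 := ℂ) A v) =
      inner ℂ u (Matrix.toEuclideanCLM (𝕜 := ℂ) (Aᴴ * A) v) := by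
  rw [map_mul, ← Matrix.star_eq_conjTranspose, map_star, ContinuousLinearMap.star_eq_adjoint,
    ← ContinuousLinearMap.adjoint_inner_right]
  rfl

lemma inner_apply_eigenvectorBasis (A : Matrix ι ι ℂ) (i j : ι) :
    inner ℂ
      (Matrix.toEuclideanCLM (𝕜 := ℂ) A
        ((Matrix.isHermitian_conjTranspose_mul_self A).eigenvectorBasis i))
      (Matrix.toEuclideanCLM (𝕜 := ℂ) A
        ((Matrix.isHermitian_conjTranspose_mul_self A).eigenvectorBasis j)) =
      if i = j then ((Matrix.isHermitian_conjTranspose_mul_self A).eigenvalues j : ℂ) else 0 := by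
  have h : Matrix.toEuclideanCLM (𝕜 := ℂ) (Aᴴ * A)
        ((Matrix.isHermitian_conjTranspose_mul_self A).eigenvectorBasis j) =
      ((Matrix.isHermitian_conjTranspose_mul_self A).eigenvalues j : ℂ) •
        (Matrix.isHermitian_conjTranspose_mul_self A).eigenvectorBasis j := by
    apply (WithLp.ofLp_injective 2)
    rw [Matrix.ofLp_toEuclideanCLM, Matrix.IsHermitian.mulVec_eigenvectorBasis]
    simp
  rw [inner_toEuclideanCLM_toEuclideanCLM, h, inner_smul_right, OrthonormalBasis.inner_eq_ite]
  simp

lemma norm_apply_eigenvectorBasis (A : Matrix ι ι ℂ) (i : ι) :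
    ‖Matrix.toEuclideanCLM (𝕜 := ℂ) A
      ((Matrix.isHermitian_conjTranspose_mul_self A).eigenvectorBasis i)‖ =
      √((Matrix.isHermitian_conjTranspose_mul_self A).eigenvalues i) := by
  rw [@norm_eq_sqrt_re_inner ℂ, inner_apply_eigenvectorBasis]
  simp

/-- The Schatten 1-norm is at most the cost `∑ ‖a m‖ ‖b m‖` of any decomposition
`A = ∑ |a m⟩⟨b m|`. -/
lemma schattenOne_le_sum_norm_mul_norm {κ : Type*} [Fintype κ] (A : Matrix ι ι ℂ)
    (a b : κ → EuclideanSpace ℂ ι)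
    (h : ∀ v, Matrix.toEuclideanCLM (𝕜 := ℂ) A v = ∑ m, inner ℂ (b m) v • a m) :
    schattenOne A ≤ ∑ m, ‖a m‖ * ‖b m‖ := by
  set hA := Matrix.isHermitian_conjTranspose_mul_self A
  set v := hA.eigenvectorBasis
  set l := hA.eigenvalues
  have hl : ∀ i, 0 ≤ l i := fun i => by
    have h1 := inner_apply_eigenvectorBasis A i i
    rw [if_pos rfl, inner_self_eq_norm_sq_to_K] at h1
    have h2 : (l i : ℂ) = ((‖Matrix.toEuclideanCLM (𝕜 := ℂ) A (v i)‖ ^ 2 : ℝ) : ℂ) := by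
      rw [← h1]; norm_cast
    rw [Complex.ofReal_inj.1 h2]
    positivity
  let s : Finset ι := Finset.univ.filter fun i => l i ≠ 0
  -- The left singular vectors `A v i / √(l i)` belonging to the nonzero singular values.
  let u : {i // l i ≠ 0} → EuclideanSpace ℂ ι := fun i =>
    ((√(l i))⁻¹ : ℂ) • Matrix.toEuclideanCLM (𝕜 := ℂ) A (v i)
  have hsq : ∀ i, ((√(l i) : ℝ) : ℂ) * ((√(l i) : ℝ) : ℂ) = (l i : ℂ) := fun i => by
    rw [← Complex.ofReal_mul, Real.mul_self_sqrt (hl i)]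
  have hne : ∀ i : {i // l i ≠ 0}, ((√(l i) : ℝ) : ℂ) ≠ 0 := fun i => by
    rw [Complex.ofReal_ne_zero]
    exact (Real.sqrt_pos.2 (lt_of_le_of_ne (hl i) (Ne.symm i.2))).ne'
  have hu : Orthonormal ℂ u := by
    rw [orthonormal_iff_ite]
    intro i j
    simp only [u, inner_smul_left, inner_smul_right]
    rw [inner_apply_eigenvectorBasis]
    by_cases hij : i = j
    · subst hij
      simp only [if_true, map_inv₀, Complex.conj_ofReal]
      change (((√(l i) : ℝ) : ℂ))⁻¹ * ((((√(l i) : ℝ) : ℂ))⁻¹ * (l i : ℂ)) = 1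
      rw [← hsq]
      field_simp [hne i]
    · have : (i : ι) ≠ j := fun h => hij (Subtype.ext h)
      simp [hij, this]
  have hv : ∀ i : {i // l i ≠ 0},
      √(l i) ≤ ∑ m, ‖inner ℂ (u i) (a m)‖ * ‖inner ℂ (b m) (v i)‖ := by
    intro i
    have h1 : inner ℂ (u i) (Matrix.toEuclideanCLM (𝕜 := ℂ) A (v i)) = ((√(l i) : ℝ) : ℂ) := by
      simp only [u, inner_smul_left]
      rw [inner_apply_eigenvectorBasis]
      simp only [if_true, map_inv₀, Complex.conj_ofReal]
      change (((√(l i) : ℝ) : ℂ))⁻¹ * (l i : ℂ) = _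
      rw [← hsq]
      field_simp [hne i]
    have h2 : √(l i) = ‖inner ℂ (u i) (Matrix.toEuclideanCLM (𝕜 := ℂ) A (v i))‖ := by
      rw [h1, Complex.norm_real, Real.norm_of_nonneg (Real.sqrt_nonneg _)]
    rw [h2, h, inner_sum]
    refine (norm_sum_le _ _).trans (Finset.sum_le_sum fun m _ => ?_)
    rw [inner_smul_right, norm_mul, mul_comm]
  have hvs : Orthonormal ℂ (fun i : {i // l i ≠ 0} => v i) :=
    v.orthonormal.comp _ Subtype.val_injective
  calc schattenOne A = ∑ i : {i // l i ≠ 0}, √(l i) := by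
        rw [schattenOne]
        change ∑ i, √(l i) = _
        rw [← Finset.sum_subtype s (p := fun i => l i ≠ 0) (by simp [s]) (fun i => √(l i)),
          Finset.sum_filter_of_ne]
        intro i _ hi hi'
        exact hi (by rw [hi', Real.sqrt_zero])
    _ ≤ ∑ i : {i // l i ≠ 0}, ∑ m, ‖inner ℂ (u i) (a m)‖ * ‖inner ℂ (b m) (v i)‖ :=
        Finset.sum_le_sum fun i _ => hv i
    _ = ∑ m, ∑ i : {i // l i ≠ 0}, ‖inner ℂ (u i) (a m)‖ * ‖inner ℂ (b m) (v i)‖ :=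
        Finset.sum_comm
    _ ≤ ∑ m, ‖a m‖ * ‖b m‖ := by
        refine Finset.sum_le_sum fun m _ => ?_
        refine (Real.sum_mul_le_sqrt_mul_sqrt _ _ _).trans ?_
        gcongr
        · exact Real.sqrt_le_iff.2 ⟨norm_nonneg _, hu.sum_inner_products_le _⟩
        · refine Real.sqrt_le_iff.2 ⟨norm_nonneg _, ?_⟩
          simp_rw [norm_inner_symm (b m)]
          exact hvs.sum_inner_products_le _

/-- The singular value decomposition `A = ∑ᵢ |A vᵢ⟩⟨vᵢ|` attains the Schatten 1-norm. -/
lemma exists_rankOne_decomposition (A : Matrix ι ι ℂ) :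
    ∃ a b : ι → EuclideanSpace ℂ ι,
      (∀ v, Matrix.toEuclideanCLM (𝕜 := ℂ) A v = ∑ m, inner ℂ (b m) v • a m) ∧
      schattenOne A = ∑ m, ‖a m‖ * ‖b m‖ := by
  set hA := Matrix.isHermitian_conjTranspose_mul_self A
  refine ⟨fun i => Matrix.toEuclideanCLM (𝕜 := ℂ) A (hA.eigenvectorBasis i),
    fun i => hA.eigenvectorBasis i, fun v => ?_, ?_⟩
  · conv_lhs => rw [← hA.eigenvectorBasis.sum_repr' v]
    simp only [map_sum, map_smul]
  · simp only [norm_apply_eigenvectorBasis, OrthonormalBasis.norm_eq_one, mul_one, schattenOne]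

lemma schattenOne_add_le (A B : Matrix ι ι ℂ) :
    schattenOne (A + B) ≤ schattenOne A + schattenOne B := by
  obtain ⟨a, b, h, hA⟩ := exists_rankOne_decomposition A
  obtain ⟨a', b', h', hB⟩ := exists_rankOne_decomposition B
  refine (schattenOne_le_sum_norm_mul_norm (A + B) (Sum.elim a a') (Sum.elim b b') ?_).trans ?_
  · intro v
    simp [h, h']
  · simp [hA, hB]

lemma schattenOne_le_sum_norm_entries (A : Matrix ι ι ℂ) :
    schattenOne A ≤ ∑ x, ∑ y, ‖A x y‖ := by
  refine (schattenOne_le_sum_norm_mul_norm A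
    (fun m : ι × ι => A m.1 m.2 • EuclideanSpace.single m.1 (1 : ℂ))
    (fun m => EuclideanSpace.single m.2 (1 : ℂ)) ?_).trans ?_
  · intro v
    ext i
    rw [Matrix.ofLp_toEuclideanCLM, Fintype.sum_prod_type]
    simp [Matrix.mulVec, dotProduct, Pi.single_apply, mul_comm, EuclideanSpace.inner_single_left]
  · rw [Fintype.sum_prod_type]
    simp [norm_smul]

/-- If the matrix `d` in an orthonormal family `F` is constant on the blocks `τ x = τ y` and vanishes
off them, then each block is a multiple of a rank-one projection; so the Schatten 1-norm is at most
the sum of the moduli of the diagonal entries. -/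
lemma schattenOne_le_sum_abs_of_blocks {κ Y : Type*} [Fintype κ] [DecidableEq Y]
    (A : Matrix ι ι ℂ) (F : κ → EuclideanSpace ℂ ι) (hF : Orthonormal ℂ F) (τ : κ → Y)
    (d : κ → ℝ) (hd : ∀ x y, τ x = τ y → d x = d y)
    (hA : ∀ u v, A u v = ∑ x, ∑ y, (if τ x = τ y then (d x : ℂ) else 0) * F x u * star (F y v)) :
    schattenOne A ≤ ∑ x, |d x| := by
  classical
  let Z := {n // n ∈ Finset.univ.image τ}
  let _ : Fintype Z := inferInstanceAs (Fintype {n // n ∈ Finset.univ.image τ})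
  let α : Z → κ → ℂ := fun n x =>
    if τ x = n then ((SignType.sign (d x) : ℝ) : ℂ) * (√|d x| : ℝ) else 0
  let β : Z → κ → ℂ := fun n x => if τ x = n then ((√|d x| : ℝ) : ℂ) else 0
  have hnorm : ∀ c : κ → ℂ, ‖∑ x, c x • F x‖ = √(∑ x, ‖c x‖ ^ 2) := by
    intro c
    rw [@norm_eq_sqrt_re_inner ℂ, hF.inner_sum]
    congr 1
    simp only [map_sum]
    refine Finset.sum_congr rfl fun x _ => ?_
    rw [mul_comm, Complex.mul_conj, Complex.normSq_eq_norm_sq]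
    exact Complex.ofReal_re _
  have hβ : ∀ n : Z, ∑ x, ‖β n x‖ ^ 2 = ∑ x, if τ x = n then |d x| else 0 := by
    intro n
    refine Finset.sum_congr rfl fun x _ => ?_
    by_cases h : τ x = n
    · simp [β, h, Real.sq_sqrt]
    · simp [β, h]
  have hα : ∀ n : Z, ∑ x, ‖α n x‖ ^ 2 ≤ ∑ x, if τ x = n then |d x| else 0 := by
    intro n
    refine Finset.sum_le_sum fun x _ => ?_
    by_cases h : τ x = n
    · simp only [α, h, if_true, norm_mul, mul_pow, Complex.norm_real, Real.norm_eq_abs, sq_abs,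
        Real.sq_sqrt (abs_nonneg (d x))]
      rcases lt_trichotomy (d x) 0 with h0 | h0 | h0 <;> simp [h0, sign_neg, sign_pos]
    · simp [α, h]
  have hsum : ∀ x, ∑ n : Z, (if τ x = n then |d x| else 0) = |d x| := by
    intro x
    rw [Finset.sum_eq_single (⟨τ x, by simp⟩ : Z)]
    · simp
    · intro n _ hn
      exact if_neg fun h => hn (Subtype.ext h.symm)
    · simp
  refine (schattenOne_le_sum_norm_mul_norm A (fun n : Z => ∑ x, α n x • F x)
    (fun n => ∑ x, β n x • F x) ?_).trans ?_
  · intro v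
    ext u
    rw [Matrix.ofLp_toEuclideanCLM]
    have key : ∀ x y, (if τ x = τ y then (d x : ℂ) else 0) = ∑ n : Z, α n x * β n y := by
      intro x y
      rw [Finset.sum_eq_single (⟨τ x, by simp⟩ : Z)]
      · by_cases h : τ x = τ y
        · have h1 : ((SignType.sign (d x) : ℝ)) * |d x| = d x := sign_mul_abs _
          simp only [h, if_true, α, β]
          rw [← hd x y h, mul_assoc, ← Complex.ofReal_mul, Real.mul_self_sqrt (abs_nonneg _),
            ← Complex.ofReal_mul, h1]
        · simp [β, h, Ne.symm h]
      · intro n _ hn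
        have : τ x ≠ n := fun h => hn (Subtype.ext h.symm)
        simp [α, this]
      · simp
    have hβs : ∀ n y, star (β n y) = β n y := by
      intro n y
      by_cases h : τ y = n <;> simp [β, h]
    have h1 : ∀ n : Z, inner ℂ (∑ x, β n x • F x) v =
        ∑ y, β n y * ∑ w, star (F y w) * v w := by
      intro n
      rw [sum_inner]
      refine Finset.sum_congr rfl fun y _ => ?_
      rw [inner_smul_left, starRingEnd_apply, hβs, PiLp.inner_apply]
      simp only [RCLike.inner_apply, starRingEnd_apply, mul_comm]
    have h2 : ∀ n : Z, (∑ x, α n x • F x) u = ∑ x, α n x * F x u := by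
      intro n
      simp [WithLp.ofLp_sum, Finset.sum_apply]
    rw [WithLp.ofLp_sum, Finset.sum_apply]
    simp only [PiLp.smul_apply, smul_eq_mul, h1, h2, Matrix.mulVec, dotProduct, hA, key]
    simp only [Finset.sum_mul, Finset.mul_sum]
    calc _ = ∑ w, ∑ n : Z, ∑ x, ∑ y, α n x * β n y * F x u * star (F y w) * v w := by
          refine Finset.sum_congr rfl fun w _ => ?_
          exact (Finset.sum_congr rfl fun x _ => Finset.sum_comm).trans Finset.sum_comm
      _ = _ := by
          rw [Finset.sum_comm]
          refine Finset.sum_congr rfl fun n _ => ?_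
          rw [Finset.sum_comm]
          refine Finset.sum_congr rfl fun x _ => ?_
          rw [Finset.sum_comm]
          refine Finset.sum_congr rfl fun y _ => ?_
          refine Finset.sum_congr rfl fun w _ => ?_
          ring
  · calc ∑ n : Z, ‖∑ x, α n x • F x‖ * ‖∑ x, β n x • F x‖
        ≤ ∑ n : Z, ∑ x, (if τ x = n then |d x| else 0) := by
          refine Finset.sum_le_sum fun n _ => ?_
          rw [hnorm, hnorm, hβ]
          have h0 : (0 : ℝ) ≤ ∑ x, if τ x = n then |d x| else 0 :=
            Finset.sum_nonneg fun x _ => by split_ifs <;> positivity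
          calc _ ≤ √(∑ x, if τ x = n then |d x| else 0) * √(∑ x, if τ x = n then |d x| else 0) := by
                exact mul_le_mul_of_nonneg_right (Real.sqrt_le_sqrt (hα n)) (Real.sqrt_nonneg _)
            _ = _ := Real.mul_self_sqrt h0
      _ = ∑ x, |d x| := by
          rw [Finset.sum_comm]
          exact Finset.sum_congr rfl fun x _ => hsum x

end SchattenOne

/-! ### Invariance and moments of the Haar measure on the sphere -/

section Haar

variable {D : ℕ}

instance : (lebesgue D).IsAddHaarMeasure :=
  (PiLp.continuousLinearEquiv 2 ℝ (fun _ : Fin D => ℂ)).symm.isAddHaarMeasure_map _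

lemma measurePreserving_lebesgue (U : Hilb D ≃ₗᵢ[ℂ] Hilb D) :
    MeasurePreserving U (lebesgue D) (lebesgue D) := by
  refine ⟨U.continuous.measurable, ?_⟩
  have : ((lebesgue D).map U).IsAddHaarMeasure :=
    AddEquiv.isAddHaarMeasure_map (lebesgue D) (U : Hilb D ≃+ Hilb D) U.continuous
      U.symm.continuous
  have h := Measure.isAddLeftInvariant_eq_smul ((lebesgue D).map U) (lebesgue D)
  have hb : (lebesgue D).map U (Metric.ball 0 1) = lebesgue D (Metric.ball 0 1) := by
    rw [Measure.map_apply U.continuous.measurable Metric.isOpen_ball.measurableSet,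
      U.preimage_ball, map_zero]
  rw [h, Measure.smul_apply, ENNReal.smul_def, smul_eq_mul] at hb
  have h0 : lebesgue D (Metric.ball 0 1) ≠ 0 := (Metric.measure_ball_pos _ _ one_pos).ne'
  have h1 : lebesgue D (Metric.ball 0 1) ≠ ∞ := measure_ball_lt_top.ne
  have hc := (ENNReal.mul_eq_right h0 h1).1 hb
  rw [h, ENNReal.coe_eq_one.1 hc, one_smul]

lemma haarState_apply {A : Set (Hilb D)} (hA : MeasurableSet A) :
    haarState D A = ((lebesgue D).toSphere Set.univ)⁻¹ *
      (Module.finrank ℝ (Hilb D) *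
        lebesgue D {z | ∃ r ∈ Set.Ioo (0 : ℝ) 1, ∃ u ∈ A, ‖u‖ = 1 ∧ r • u = z}) := by
  rw [haarState, Measure.map_apply measurable_subtype_coe hA, Measure.smul_apply, smul_eq_mul,
    Measure.toSphere_apply' _ (measurable_subtype_coe hA)]
  congr 3
  ext z
  simp only [Set.mem_smul, Set.mem_image, Set.mem_preimage, Subtype.exists, mem_sphere_zero_iff_norm,
    Set.mem_ofPred_eq]
  constructor
  · rintro ⟨r, hr, _, ⟨u, hu, huA, rfl⟩, rfl⟩
    exact ⟨r, hr, u, huA, hu, rfl⟩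
  · rintro ⟨r, hr, u, huA, hu, rfl⟩
    exact ⟨r, hr, u, ⟨u, hu, huA, rfl⟩, rfl⟩

lemma measurePreserving_haarState (U : Hilb D ≃ₗᵢ[ℂ] Hilb D) :
    MeasurePreserving U (haarState D) (haarState D) := by
  refine ⟨U.continuous.measurable, ?_⟩
  ext A hA
  rw [Measure.map_apply U.continuous.measurable hA, haarState_apply hA,
    haarState_apply (U.continuous.measurable hA)]
  congr 2
  symm
  rw [← (measurePreserving_lebesgue U).measure_preimage_emb
    U.toHomeomorph.measurableEmbedding]
  congr 1
  ext z
  simp only [Set.mem_preimage, Set.mem_ofPred_eq]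
  have hU : ∀ (r : ℝ) (u : Hilb D), U (r • u) = r • U u := fun r u => by
    simpa using U.map_smul (r : ℂ) u
  constructor
  · rintro ⟨r, hr, u, huA, hu, h⟩
    exact ⟨r, hr, U.symm u, by simpa using huA, by simpa using hu,
      U.injective (by rw [hU, U.apply_symm_apply, h])⟩
  · rintro ⟨r, hr, u, huA, hu, rfl⟩
    exact ⟨r, hr, U u, huA, by simpa using hu, (hU r u).symm⟩

lemma ae_norm_haarState : ∀ᵐ φ ∂haarState D, ‖φ‖ = 1 := by
  rw [haarState, ae_map_iff measurable_subtype_coe.aemeasurable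
    (measurableSet_eq_fun (by fun_prop) (by fun_prop))]
  exact ae_of_all _ fun u => by simp

instance [NeZero D] : IsProbabilityMeasure (haarState D) := by
  refine ⟨?_⟩
  rw [haarState, Measure.map_apply measurable_subtype_coe .univ, Set.preimage_univ,
    Measure.smul_apply, smul_eq_mul]
  have : Nontrivial (Hilb D) := ⟨⟨EuclideanSpace.single 0 1, 0, by simp⟩⟩
  exact ENNReal.inv_mul_cancel (Measure.measure_univ_ne_zero.2 (Measure.toSphere_ne_zero _))
    (measure_ne_top _ _)

lemma integral_haarState (f : Hilb D → ℝ) :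
    ∫ φ, f φ ∂haarState D =
      ((lebesgue D).toSphere.real Set.univ)⁻¹ * ∫ u, f u ∂(lebesgue D).toSphere := by
  rw [haarState, (MeasurableEmbedding.subtype_coe
    (Metric.isClosed_sphere.measurableSet)).integral_map, integral_smul_measure,
    ENNReal.toReal_inv]
  rfl

lemma integral_norm_pow_mul_exp_neg (n : ℕ) :
    ∫ z : ℂ, ‖z‖ ^ (2 * n) * Real.exp (-‖z‖ ^ 2) = Real.pi * (n.factorial : ℝ) := by
  have h := Complex.integral_rpow_mul_exp_neg_rpow (p := 2) (q := 2 * n) (by norm_num)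
    (by have : (0 : ℝ) ≤ n := n.cast_nonneg
        linarith)
  rw [show (2 * (n : ℝ) + 2) / 2 = n + 1 by ring, Real.Gamma_nat_eq_factorial] at h
  rw [show Real.pi = 2 * Real.pi / 2 by ring, ← h]
  congr 1
  ext z
  rw [← Real.rpow_natCast, ← Real.rpow_natCast]
  push_cast
  rfl

lemma integral_gaussian_monomial (n : Fin D → ℕ) :
    ∫ z, (∏ j, ‖z j‖ ^ (2 * n j)) * Real.exp (-‖z‖ ^ 2) ∂lebesgue D =
      Real.pi ^ D * ∏ j, ((n j).factorial : ℝ) := by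
  have hmap : lebesgue D = (volume : Measure (Fin D → ℂ)).map (MeasurableEquiv.toLp 2 _) := rfl
  rw [hmap, integral_map_equiv]
  have h : ∀ z : Fin D → ℂ, (∏ j, ‖(MeasurableEquiv.toLp 2 _ z : Hilb D) j‖ ^ (2 * n j)) *
      Real.exp (-‖(MeasurableEquiv.toLp 2 _ z : Hilb D)‖ ^ 2) =
      ∏ j, (‖z j‖ ^ (2 * n j) * Real.exp (-‖z j‖ ^ 2)) := by
    intro z
    rw [EuclideanSpace.norm_sq_eq, ← Finset.sum_neg_distrib, Real.exp_sum, ← Finset.prod_mul_distrib]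
    rfl
  simp_rw [h]
  rw [integral_fintype_prod_volume_eq_prod (fun j (z : ℂ) => ‖z‖ ^ (2 * n j) * Real.exp (-‖z‖ ^ 2))]
  simp_rw [integral_norm_pow_mul_exp_neg]
  rw [Finset.prod_mul_distrib]
  simp

/-- Separation of variables in polar coordinates for a Gaussian moment. -/
lemma integral_gaussian_monomial_eq_mul [NeZero D] (n : Fin D → ℕ) :
    ∫ z, (∏ j, ‖z j‖ ^ (2 * n j)) * Real.exp (-‖z‖ ^ 2) ∂lebesgue D =
      (∫ u : Metric.sphere (0 : Hilb D) 1, ∏ j, ‖u.1 j‖ ^ (2 * n j) ∂(lebesgue D).toSphere) *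
        ∫ r : Set.Ioi (0 : ℝ), r.1 ^ (2 * ∑ j, n j) * Real.exp (-r.1 ^ 2)
          ∂(Measure.volumeIoiPow (Module.finrank ℝ (Hilb D) - 1)) := by
  set f : Hilb D → ℝ := fun z => (∏ j, ‖z j‖ ^ (2 * n j)) * Real.exp (-‖z‖ ^ 2)
  have h1 : ∫ z, f z ∂lebesgue D =
      ∫ z : ({(0)}ᶜ : Set (Hilb D)), f z.1 ∂((lebesgue D).comap (↑)) := by
    rw [integral_subtype_comap (measurableSet_singleton _).compl f, restrict_compl_singleton]
  have h2 := ((lebesgue D).measurePreserving_homeomorphUnitSphereProd).integral_comp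
        (Homeomorph.measurableEmbedding _)
        (fun p : Metric.sphere (0 : Hilb D) 1 × Set.Ioi (0 : ℝ) =>
          (∏ j, ‖p.1.1 j‖ ^ (2 * n j)) * (p.2.1 ^ (2 * ∑ j, n j) * Real.exp (-p.2.1 ^ 2)))
  rw [← integral_prod_mul, ← h2]
  change ∫ z, f z ∂lebesgue D = _
  rw [h1]
  congr 1
  ext z
  have hz : ‖z.1‖ ≠ 0 := norm_ne_zero_iff.2 z.2
  simp only [f, homeomorphUnitSphereProd_apply_fst_coe, homeomorphUnitSphereProd_apply_snd_coe]
  rw [← mul_assoc, Finset.mul_sum, ← Finset.prod_pow_eq_pow_sum, ← Finset.prod_mul_distrib]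
  congr 1
  refine Finset.prod_congr rfl fun j _ => ?_
  rw [PiLp.smul_apply, norm_smul, norm_inv, norm_norm, ← mul_pow]
  congr 1
  field_simp

lemma integrable_sphere_monomial (n : Fin D → ℕ) :
    Integrable (fun u : Metric.sphere (0 : Hilb D) 1 => ∏ j, ‖u.1 j‖ ^ (2 * n j))
      (lebesgue D).toSphere := by
  refine Continuous.integrable_of_hasCompactSupport (by fun_prop) ?_
  exact HasCompactSupport.of_compactSpace _

/-- The moments of the moduli of the coordinates of a Haar random unit vector of `ℂ^D`. -/
theorem integral_haarState_monomial [NeZero D] (n : Fin D → ℕ) :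
    ∫ φ, ∏ j, ‖φ j‖ ^ (2 * n j) ∂haarState D =
      (∏ j, ((n j).factorial : ℝ)) / D.ascFactorial (∑ j, n j) := by
  set F : (Fin D → ℕ) → ℝ := fun n =>
    ∫ u : Metric.sphere (0 : Hilb D) 1, ∏ j, ‖u.1 j‖ ^ (2 * n j) ∂(lebesgue D).toSphere
  set I : ℕ → ℝ := fun m => ∫ r : Set.Ioi (0 : ℝ), r.1 ^ (2 * m) * Real.exp (-r.1 ^ 2)
          ∂(Measure.volumeIoiPow (Module.finrank ℝ (Hilb D) - 1))
  have hFI : ∀ n, F n * I (∑ j, n j) = Real.pi ^ D * ∏ j, ((n j).factorial : ℝ) := fun n => by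
    rw [← integral_gaussian_monomial, integral_gaussian_monomial_eq_mul]
  have hpos : ∀ n : Fin D → ℕ, (0 : ℝ) < Real.pi ^ D * ∏ j, ((n j).factorial : ℝ) := fun n =>
    mul_pos (pow_pos Real.pi_pos _) (Finset.prod_pos fun j _ => by positivity)
  have hsum : ∀ m, ∑ j, (Pi.single (0 : Fin D) m : Fin D → ℕ) j = m := fun m => by simp
  have hI : ∀ m, I m ≠ 0 := fun m h => by
    have := hFI (Pi.single 0 m)
    rw [hsum, h, mul_zero] at this
    exact (hpos _).ne this
  -- `∑ⱼ |uⱼ|² = 1` on the sphere turns into the recursion for the radial integrals.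
  have hrec : ∀ m : ℕ, (D + m : ℝ) * I m = I (m + 1) := by
    intro m
    set e : Fin D → ℕ := Pi.single 0 m
    have h1 : F e = ∑ j, F (e + Pi.single j 1) := by
      simp only [F]
      rw [← integral_finsetSum _ fun j _ => integrable_sphere_monomial _]
      congr 1
      ext u
      have hu : ∑ j, ‖u.1 j‖ ^ 2 = 1 := by
        rw [← EuclideanSpace.norm_sq_eq]
        simp
      have h2 : ∀ j, ∏ i, ‖u.1 i‖ ^ (2 * (e + Pi.single j 1 : Fin D → ℕ) i) =
          (∏ i, ‖u.1 i‖ ^ (2 * e i)) * ‖u.1 j‖ ^ 2 := by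
        intro j
        simp only [Pi.add_apply, mul_add, pow_add, Finset.prod_mul_distrib]
        congr 1
        rw [Finset.prod_eq_single j] <;> simp +contextual
      simp_rw [h2, ← Finset.mul_sum, hu, mul_one]
    have h3 : ∀ j, F (e + Pi.single j 1) * I (m + 1) =
        (Real.pi ^ D * ∏ i, ((e i).factorial : ℝ)) * (e j + 1) := by
      intro j
      have h4 : ∑ i, (e + Pi.single j 1 : Fin D → ℕ) i = m + 1 := by
        simp [Finset.sum_add_distrib, e]
      rw [← h4, hFI, mul_assoc]
      congr 1
      rw [← Finset.mul_prod_erase _ _ (Finset.mem_univ j),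
        ← Finset.mul_prod_erase _ (fun i => ((e i).factorial : ℝ)) (Finset.mem_univ j)]
      have : ∀ i ∈ Finset.univ.erase j, (((e + Pi.single j 1 : Fin D → ℕ) i).factorial : ℝ) = (e i).factorial := by
        intro i hi
        simp [Finset.ne_of_mem_erase hi]
      rw [Finset.prod_congr rfl this]
      simp only [Pi.add_apply, Pi.single_eq_same, Nat.factorial_succ]
      push_cast
      ring
    have h5 : F e * I (m + 1) = (Real.pi ^ D * ∏ i, ((e i).factorial : ℝ)) * (D + m) := by
      rw [h1, Finset.sum_mul, Finset.sum_congr rfl fun j _ => h3 j, ← Finset.mul_sum]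
      congr 1
      rw [Finset.sum_add_distrib, ← Nat.cast_sum, hsum]
      simp [add_comm]
    have h6 := hFI e
    rw [hsum] at h6
    have hF : F e ≠ 0 := left_ne_zero_of_mul (h6 ▸ (hpos e).ne')
    apply mul_left_cancel₀ hF
    rw [h5, ← h6]
    ring
  have hasc : ∀ m, I m = D.ascFactorial m * I 0 := by
    intro m
    induction m with
    | zero => simp
    | succ m ih =>
      rw [← hrec, ih, Nat.ascFactorial_succ]
      push_cast
      ring
  have hF0 : F 0 = (lebesgue D).toSphere.real Set.univ := by simp [F]
  have h0 : F 0 * I 0 = Real.pi ^ D := by simpa using hFI 0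
  rw [integral_haarState, ← hF0]
  change (F 0)⁻¹ * F n = _
  have hF0' : F 0 ≠ 0 := left_ne_zero_of_mul (h0 ▸ (pow_pos Real.pi_pos D).ne')
  have ha : (D.ascFactorial (∑ j, n j) : ℝ) ≠ 0 := by
    intro h
    exact hI (∑ j, n j) (by rw [hasc, h, zero_mul])
  have hn := hFI n
  rw [hasc, ← h0] at hn
  field_simp
  apply mul_right_cancel₀ (hI 0)
  linear_combination hn

end Haar

/-! ### Occupation numbers -/

section Occupation

variable {D k : ℕ}

/-- The occupation numbers of a word `x` of length `k` in the letters `Fin D`: the number of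
occurrences of each letter. -/
def occ (x : Fin k → Fin D) (j : Fin D) : ℕ := (Finset.univ.filter fun i => x i = j).card

lemma prod_comp_eq_prod_pow_occ {M : Type*} [CommMonoid M] (f : Fin D → M) (x : Fin k → Fin D) :
    ∏ i, f (x i) = ∏ j, f j ^ occ x j := by
  rw [← Finset.prod_fiberwise Finset.univ x]
  refine Finset.prod_congr rfl fun j _ => ?_
  rw [Finset.prod_congr rfl (g := fun _ => f j), Finset.prod_const, occ]
  intro i hi
  rw [(Finset.mem_filter.1 hi).2]

lemma sum_occ_mul (f : Fin D → ℝ) (x : Fin k → Fin D) :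
    ∑ j, (occ x j : ℝ) * f j = ∑ i, f (x i) := by
  rw [← Finset.sum_fiberwise Finset.univ x]
  refine Finset.sum_congr rfl fun j _ => ?_
  rw [Finset.sum_congr rfl (g := fun _ => f j), Finset.sum_const, occ, nsmul_eq_mul]
  intro i hi
  rw [(Finset.mem_filter.1 hi).2]

lemma sum_occ (x : Fin k → Fin D) : ∑ j, occ x j = k := by
  have h := sum_occ_mul (fun _ => 1) x
  simp only [mul_one, Finset.sum_const, Finset.card_univ, Fintype.card_fin, nsmul_eq_mul] at h
  exact_mod_cast h

lemma occ_eq_iff {x y : Fin k → Fin D} :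
    occ x = occ y ↔ ∃ π : Equiv.Perm (Fin k), ∀ i, y i = x (π i) := by
  constructor
  · intro h
    have e : ∀ j, {i // y i = j} ≃ {i // x i = j} := fun j => Fintype.equivOfCardEq (by
      rw [Fintype.card_subtype, Fintype.card_subtype]
      exact (congrFun h j).symm)
    exact ⟨Equiv.ofFiberEquiv e, fun i => (Equiv.ofFiberEquiv_map e i).symm⟩
  · rintro ⟨π, h⟩
    ext j
    refine (Finset.card_bij (fun i _ => π i) ?_ (fun _ _ _ _ h => π.injective h) ?_).symm
    · intro i hi
      simpa [h] using hi
    · intro i hi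
      exact ⟨π.symm i, by simpa [h] using hi, by simp⟩

lemma sum_word_prod (f : Fin k → Fin D → ℝ) :
    ∑ x : Fin k → Fin D, ∏ i, f i (x i) = ∏ i, ∑ j, f i j := by
  rw [Finset.prod_univ_sum, Fintype.piFinset_univ]

end Occupation

/-! ### Moments in a product basis -/

section Moments

variable {D k : ℕ} (E : OrthonormalBasis (Fin D) ℂ (Hilb D))

/-- The product vector `E_{x₁} ⊗ ⋯ ⊗ E_{xₖ}`. -/
noncomputable def tensorVec (x : Fin k → Fin D) : EuclideanSpace ℂ (Fin k → Fin D) :=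
  WithLp.toLp 2 fun u => ∏ i, E (x i) (u i)

lemma orthonormal_tensorVec : Orthonormal ℂ (tensorVec (k := k) E) := by
  rw [orthonormal_iff_ite]
  intro x y
  have h : inner ℂ (tensorVec E x) (tensorVec E y) = ∏ i, inner ℂ (E (x i)) (E (y i)) := by
    simp only [PiLp.inner_apply, tensorVec, RCLike.inner_apply, map_prod,
      ← Finset.prod_mul_distrib]
    rw [Finset.prod_univ_sum, Fintype.piFinset_univ]
  rw [h]
  simp only [OrthonormalBasis.inner_eq_ite]
  rw [Finset.prod_ite_zero]
  simp [funext_iff]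

/-- The `(x, y)` matrix element of the `k`-th moment operator of `μ` in the product basis of `E`. -/
noncomputable def coeffMoment (μ : Measure (Hilb D)) (x y : Fin k → Fin D) : ℂ :=
  ∫ ψ, ∏ i, (inner ℂ (E (x i)) ψ * star (inner ℂ (E (y i)) ψ)) ∂μ

lemma continuous_coeff (x y : Fin k → Fin D) :
    Continuous fun ψ : Hilb D => ∏ i, (inner ℂ (E (x i)) ψ * star (inner ℂ (E (y i)) ψ)) := by
  fun_prop

lemma norm_coeff_le (x y : Fin k → Fin D) {ψ : Hilb D} (hψ : ‖ψ‖ ≤ 1) :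
    ‖∏ i, (inner ℂ (E (x i)) ψ * star (inner ℂ (E (y i)) ψ))‖ ≤ 1 := by
  rw [norm_prod]
  refine Finset.prod_le_one (fun _ _ => norm_nonneg _) fun i _ => ?_
  have h : ∀ j, ‖inner ℂ (E j) ψ‖ ≤ 1 := fun j =>
    (norm_inner_le_norm _ _).trans (by rw [E.norm_eq_one, one_mul]; exact hψ)
  rw [norm_mul, norm_star]
  exact mul_le_one₀ (h _) (norm_nonneg _) (h _)

lemma integrable_coeff {μ : Measure (Hilb D)} [IsFiniteMeasure μ] (hμ : ∀ᵐ ψ ∂μ, ‖ψ‖ ≤ 1)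
    (x y : Fin k → Fin D) :
    Integrable (fun ψ => ∏ i, (inner ℂ (E (x i)) ψ * star (inner ℂ (E (y i)) ψ))) μ :=
  Integrable.of_bound (continuous_coeff E x y).aestronglyMeasurable 1
    (hμ.mono fun _ h => norm_coeff_le E x y h)

lemma projPow_eq_sum (ψ : Hilb D) (u v : Fin k → Fin D) :
    projPow k ψ u v = ∑ x, ∑ y, (∏ i, (inner ℂ (E (x i)) ψ * star (inner ℂ (E (y i)) ψ))) *
      tensorVec E x u * star (tensorVec E y v) := by
  have h : ∀ u : Fin k → Fin D,
      ∏ i, ψ (u i) = ∑ x : Fin k → Fin D, (∏ i, inner ℂ (E (x i)) ψ) * tensorVec E x u := by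
    intro u
    have h1 : ∀ a, ψ a = ∑ j, inner ℂ (E j) ψ * E j a := by
      intro a
      conv_lhs => rw [← E.sum_repr' ψ]
      simp [WithLp.ofLp_sum, Finset.sum_apply]
    simp_rw [h1 (u _)]
    rw [Finset.prod_univ_sum, Fintype.piFinset_univ]
    simp only [Finset.prod_mul_distrib, tensorVec]
  rw [projPow, Matrix.of_apply, Finset.prod_mul_distrib, ← star_prod, h u, h v, star_sum,
    Finset.sum_mul_sum]
  refine Finset.sum_congr rfl fun x _ => Finset.sum_congr rfl fun y _ => ?_
  rw [Finset.prod_mul_distrib, star_mul', star_prod]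
  ring

lemma moment_eq_sum {μ : Measure (Hilb D)} [IsFiniteMeasure μ] (hμ : ∀ᵐ ψ ∂μ, ‖ψ‖ ≤ 1)
    (u v : Fin k → Fin D) :
    moment k μ u v = ∑ x, ∑ y, coeffMoment E μ x y * tensorVec E x u * star (tensorVec E y v) := by
  have hi : ∀ x y : Fin k → Fin D, Integrable (fun ψ =>
      (∏ i, (inner ℂ (E (x i)) ψ * star (inner ℂ (E (y i)) ψ))) *
      tensorVec E x u * star (tensorVec E y v)) μ := fun x y =>
    ((integrable_coeff E hμ x y).mul_const _).mul_const _
  rw [moment, Matrix.of_apply]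
  simp_rw [projPow_eq_sum E]
  rw [integral_finsetSum _ fun x _ => integrable_finsetSum _ fun y _ => hi x y]
  refine Finset.sum_congr rfl fun x _ => ?_
  rw [integral_finsetSum _ fun y _ => hi x y]
  refine Finset.sum_congr rfl fun y _ => ?_
  rw [integral_mul_const, integral_mul_const, coeffMoment]

end Moments

/-! ### The random phase ensemble -/

section RandomPhase

variable {D k : ℕ} (E : OrthonormalBasis (Fin D) ℂ (Hilb D)) (Ψ₀ : Hilb D)

/-- The populations `|⟨Eⱼ|Ψ₀⟩|²`. -/
noncomputable def pop (j : Fin D) : ℝ := ‖inner ℂ (E j) Ψ₀‖ ^ 2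

lemma pop_nonneg (j : Fin D) : 0 ≤ pop E Ψ₀ j := sq_nonneg _

variable {Ψ₀} in
lemma sum_pop (h : ‖Ψ₀‖ = 1) : ∑ j, pop E Ψ₀ j = 1 := by
  simp only [pop]
  rw [E.sum_sq_norm_inner_right, h, one_pow]

lemma norm_eq_one_of_norm_inner {ψ : Hilb D} (h₀ : ‖Ψ₀‖ = 1)
    (h : ∀ j, ‖inner ℂ (E j) ψ‖ = ‖inner ℂ (E j) Ψ₀‖) : ‖ψ‖ = 1 := by
  have h1 : ‖ψ‖ ^ 2 = 1 := by
    rw [← E.sum_sq_norm_inner_right]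
    simp_rw [h]
    exact sum_pop E h₀
  exact (pow_eq_one_iff_of_nonneg (norm_nonneg ψ) two_ne_zero).1 h1

lemma inner_phaseState (φ : Fin D → ℝ) (j : Fin D) :
    inner ℂ (E j) (phaseState E Ψ₀ φ) =
      (‖inner ℂ (E j) Ψ₀‖ : ℂ) * Complex.exp (Complex.I * (φ j : ℂ)) := by
  rw [phaseState, E.orthonormal.inner_right_fintype]

lemma continuous_phaseState : Continuous (phaseState E Ψ₀) := by
  unfold phaseState
  fun_prop

instance : IsProbabilityMeasure ((volume : Measure ℝ)[|Set.Ico 0 (2 * Real.pi)]) := by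
  refine cond_isProbabilityMeasure_of_finite ?_ ?_ <;> rw [Real.volume_Ico]
  · simp [Real.pi_pos]
  · exact ENNReal.ofReal_ne_top

variable {Ψ₀} in
lemma isPureStateEnsemble_randomPhase (h : ‖Ψ₀‖ = 1) :
    IsPureStateEnsemble (randomPhase E Ψ₀) := by
  refine ⟨Measure.isProbabilityMeasure_map (continuous_phaseState E Ψ₀).aemeasurable, ?_⟩
  rw [randomPhase, ae_map_iff (continuous_phaseState E Ψ₀).aemeasurable
    (measurableSet_eq_fun (by fun_prop) (by fun_prop))]
  refine ae_of_all _ fun φ => norm_eq_one_of_norm_inner E Ψ₀ h fun j => ?_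
  rw [inner_phaseState, norm_mul, mul_comm Complex.I, Complex.norm_exp_ofReal_mul_I]
  simp

lemma integral_cond_exp (m : ℤ) :
    ∫ t, Complex.exp (Complex.I * (t : ℂ)) ^ m ∂((volume : Measure ℝ)[|Set.Ico 0 (2 * Real.pi)]) =
      if m = 0 then 1 else 0 := by
  split_ifs with hm
  · simp [hm]
  · have h : ∀ t : ℝ, Complex.exp (Complex.I * (t : ℂ)) ^ m =
        Complex.exp ((m * Complex.I) * (t : ℂ)) := fun t => by
      rw [← Complex.exp_int_mul, mul_assoc]
    simp_rw [h]
    rw [ProbabilityTheory.cond, integral_smul_measure, Measure.restrict_congr_set Ico_ae_eq_Ioc,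
      ← intervalIntegral.integral_of_le (by positivity), integral_exp_mul_complex]
    · have : Complex.exp (m * Complex.I * ((2 * Real.pi : ℝ) : ℂ)) = 1 := by
        rw [Complex.exp_eq_one_iff]
        exact ⟨m, by push_cast; ring⟩
      rw [this]
      simp
    · simp [hm]

lemma prod_norm_mul_norm_eq {x y : Fin k → Fin D} (h : occ x = occ y) :
    ∏ i, ((‖inner ℂ (E (x i)) Ψ₀‖ : ℂ) * (‖inner ℂ (E (y i)) Ψ₀‖ : ℂ)) =
      ((∏ i, pop E Ψ₀ (x i) : ℝ) : ℂ) := by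
  rw [Finset.prod_mul_distrib, prod_comp_eq_prod_pow_occ (fun j => (‖inner ℂ (E j) Ψ₀‖ : ℂ)) y,
    ← h, ← prod_comp_eq_prod_pow_occ (fun j => (‖inner ℂ (E j) Ψ₀‖ : ℂ)) x,
    ← Finset.prod_mul_distrib]
  push_cast [pop]
  simp_rw [sq]

lemma coeffMoment_randomPhase (x y : Fin k → Fin D) :
    coeffMoment E (randomPhase E Ψ₀) x y =
      if occ x = occ y then ((∏ i, pop E Ψ₀ (x i) : ℝ) : ℂ) else 0 := by
  rw [coeffMoment, randomPhase, integral_map (continuous_phaseState E Ψ₀).aemeasurable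
    (continuous_coeff E x y).aestronglyMeasurable]
  have h : ∀ φ : Fin D → ℝ, ∏ i, (inner ℂ (E (x i)) (phaseState E Ψ₀ φ) *
        star (inner ℂ (E (y i)) (phaseState E Ψ₀ φ))) =
      (∏ i, ((‖inner ℂ (E (x i)) Ψ₀‖ : ℂ) * (‖inner ℂ (E (y i)) Ψ₀‖ : ℂ))) *
        ∏ j, Complex.exp (Complex.I * (φ j : ℂ)) ^ ((occ x j : ℤ) - (occ y j : ℤ)) := by
    intro φ
    have hs : ∀ j, star (Complex.exp (Complex.I * (φ j : ℂ))) =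
        (Complex.exp (Complex.I * (φ j : ℂ)))⁻¹ := fun j => by
      rw [← Complex.exp_neg, RCLike.star_def, ← Complex.exp_conj]
      simp
    simp_rw [inner_phaseState, star_mul', hs]
    rw [Finset.prod_congr rfl fun j _ => zpow_sub₀ (Complex.exp_ne_zero _) _ _]
    simp_rw [zpow_natCast, div_eq_mul_inv]
    rw [Finset.prod_mul_distrib (f := fun j => Complex.exp (Complex.I * (φ j : ℂ)) ^ occ x j),
      Finset.prod_inv_distrib,
      ← prod_comp_eq_prod_pow_occ (fun j => Complex.exp (Complex.I * (φ j : ℂ))),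
      ← prod_comp_eq_prod_pow_occ (fun j => Complex.exp (Complex.I * (φ j : ℂ))),
      ← Finset.prod_inv_distrib, ← Finset.prod_mul_distrib, ← Finset.prod_mul_distrib]
    refine Finset.prod_congr rfl fun i _ => ?_
    simp only [RCLike.star_def, Complex.conj_ofReal]
    ring
  simp_rw [h]
  rw [integral_const_mul, integral_fintype_prod_eq_prod (fun (j : Fin D) (t : ℝ) =>
    Complex.exp (Complex.I * (t : ℂ)) ^ ((occ x j : ℤ) - (occ y j : ℤ)))]
  simp_rw [integral_cond_exp]
  split_ifs with hxy
  · rw [prod_norm_mul_norm_eq E Ψ₀ hxy]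
    simp [hxy]
  · obtain ⟨j, hj⟩ := Function.ne_iff.1 hxy
    rw [Finset.prod_eq_zero (Finset.mem_univ j), mul_zero]
    rw [if_neg]
    omega

end RandomPhase

/-! ### The temporal ensemble -/

section Temporal

variable {D k : ℕ} {H : Matrix (Fin D) (Fin D) ℂ} {E : OrthonormalBasis (Fin D) ℂ (Hilb D)}
  {e : Fin D → ℝ} (Ψ₀ : Hilb D)

lemma act_pow_eigen {A : Matrix (Fin D) (Fin D) ℂ} {v : Hilb D} {c : ℂ} (h : act A v = c • v)
    (n : ℕ) : act (A ^ n) v = c ^ n • v := by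
  induction n with
  | zero => simp [act]
  | succ n ih =>
    have h1 : act (A ^ (n + 1)) v = act (A ^ n) (act A v) := by
      simp only [act, pow_succ, map_mul]
      rfl
    rw [h1, h]
    have h2 : act (A ^ n) (c • v) = c • act (A ^ n) v := by simp [act]
    rw [h2, ih, smul_smul, pow_succ']

open scoped Matrix.Norms.Operator in
lemma act_exp_eigen {A : Matrix (Fin D) (Fin D) ℂ} {v : Hilb D} {c : ℂ} (h : act A v = c • v) :
    act (NormedSpace.exp A) v = Complex.exp c • v := by
  let L : Matrix (Fin D) (Fin D) ℂ →ₗ[ℂ] Hilb D :=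
    { toFun := fun B => act B v
      map_add' := fun B C => by simp [act]
      map_smul' := fun c B => by simp [act] }
  have hL : Continuous L := L.continuous_of_finiteDimensional
  have h1 := (NormedSpace.exp_series_hasSum_exp' (𝕂 := ℂ) A).map L hL
  have h2 : HasSum (fun n : ℕ => ((n.factorial : ℂ)⁻¹ • c ^ n) • v) (Complex.exp c • v) := by
    rw [Complex.exp_eq_exp_ℂ]
    exact (NormedSpace.exp_series_hasSum_exp' (𝕂 := ℂ) c).smul_const v
  refine h1.unique ?_
  convert h2 using 2 with n
  simp only [Function.comp_apply, map_smul, smul_assoc]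
  congr 1
  exact act_pow_eigen h n

lemma evolve_eq (hH : IsEigensystem H E e) (t : ℝ) :
    evolve H Ψ₀ t = ∑ j, (inner ℂ (E j) Ψ₀ * Complex.exp (-(Complex.I * t) * e j)) • E j := by
  have h1 : ∀ j, act (NormedSpace.exp ((-(Complex.I * (t : ℂ))) • H)) (E j) =
      Complex.exp (-(Complex.I * t) * e j) • E j := by
    intro j
    refine act_exp_eigen ?_
    have := hH.eigen j
    simp only [act] at this ⊢
    rw [map_smul, smul_apply, this, smul_smul]
  rw [evolve]
  conv_lhs => rw [← E.sum_repr' Ψ₀]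
  simp only [act] at h1 ⊢
  rw [map_sum]
  refine Finset.sum_congr rfl fun j _ => ?_
  rw [map_smul, h1, smul_smul]

lemma inner_evolve (hH : IsEigensystem H E e) (t : ℝ) (j : Fin D) :
    inner ℂ (E j) (evolve H Ψ₀ t) =
      inner ℂ (E j) Ψ₀ * Complex.exp (-(Complex.I * t) * e j) := by
  rw [evolve_eq Ψ₀ hH, E.orthonormal.inner_right_fintype]

lemma continuous_evolve (hH : IsEigensystem H E e) : Continuous (evolve H Ψ₀) := by
  simp_rw [funext (evolve_eq Ψ₀ hH)]
  fun_prop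

lemma isPureStateEnsemble_temporal {Ψ₀ : Hilb D} (h : ‖Ψ₀‖ = 1) (hH : IsEigensystem H E e) {T : ℝ}
    (hT : 0 < T) : IsPureStateEnsemble (temporal H Ψ₀ T) := by
  have : IsProbabilityMeasure ((volume : Measure ℝ)[|Set.Icc 0 T]) := by
    refine cond_isProbabilityMeasure_of_finite ?_ ?_ <;> simp [hT]
  refine ⟨Measure.isProbabilityMeasure_map (continuous_evolve Ψ₀ hH).aemeasurable, ?_⟩
  rw [temporal, ae_map_iff (continuous_evolve Ψ₀ hH).aemeasurable
    (measurableSet_eq_fun (by fun_prop) (by fun_prop))]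
  refine ae_of_all _ fun t => norm_eq_one_of_norm_inner E Ψ₀ h fun j => ?_
  rw [inner_evolve Ψ₀ hH, norm_mul]
  have : -(Complex.I * (t : ℂ)) * e j = ((-(t * e j) : ℝ) : ℂ) * Complex.I := by push_cast; ring
  rw [this, Complex.norm_exp_ofReal_mul_I, mul_one]

/-- The Cesàro mean of an oscillating exponential. -/
lemma tendsto_integral_cond_exp (ω : ℝ) :
    Tendsto (fun T : ℝ => ∫ t, Complex.exp (Complex.I * ω * (t : ℂ))
      ∂((volume : Measure ℝ)[|Set.Icc 0 T])) atTop (𝓝 (if ω = 0 then 1 else 0)) := by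
  have h : ∀ T : ℝ, 0 < T → ∫ t, Complex.exp (Complex.I * ω * (t : ℂ))
      ∂((volume : Measure ℝ)[|Set.Icc 0 T]) =
      (T⁻¹ : ℝ) • ∫ t in (0 : ℝ)..T, Complex.exp (Complex.I * ω * (t : ℂ)) := by
    intro T hT
    rw [ProbabilityTheory.cond, integral_smul_measure, intervalIntegral.integral_of_le hT.le,
      Measure.restrict_congr_set Ioc_ae_eq_Icc]
    simp [hT.le]
  split_ifs with hω
  · refine tendsto_const_nhds.congr' ?_
    filter_upwards [eventually_gt_atTop 0] with T hT
    rw [h T hT, hω]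
    simp [hT.ne']
  · have hne : Complex.I * (ω : ℂ) ≠ 0 := by simp [hω]
    rw [tendsto_zero_iff_norm_tendsto_zero]
    refine squeeze_zero' (g := fun T : ℝ => T⁻¹ * (2 / ‖Complex.I * (ω : ℂ)‖))
      (Eventually.of_forall fun _ => norm_nonneg _) ?_ ?_
    · filter_upwards [eventually_gt_atTop 0] with T hT
      rw [h T hT, integral_exp_mul_complex hne, norm_smul, norm_div, Real.norm_of_nonneg (by positivity)]
      gcongr
      refine (norm_sub_le _ _).trans ?_
      have : ∀ s : ℝ, ‖Complex.exp (Complex.I * ω * (s : ℂ))‖ = 1 := fun s => by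
        rw [show Complex.I * ω * (s : ℂ) = ((ω * s : ℝ) : ℂ) * Complex.I by push_cast; ring,
          Complex.norm_exp_ofReal_mul_I]
      rw [this, this]
      norm_num
    · simpa using tendsto_inv_atTop_zero.mul_const (2 / ‖Complex.I * (ω : ℂ)‖)

lemma tendsto_coeffMoment_temporal (hH : IsEigensystem H E e) (hk : NoResonance k e)
    (x y : Fin k → Fin D) :
    Tendsto (fun T : ℝ => coeffMoment E (temporal H Ψ₀ T) x y) atTop
      (𝓝 (coeffMoment E (randomPhase E Ψ₀) x y)) := by
  set c : ℂ := ∏ i, (inner ℂ (E (x i)) Ψ₀ * star (inner ℂ (E (y i)) Ψ₀))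
  set ω : ℝ := ∑ i, e (y i) - ∑ i, e (x i)
  have h : ∀ T : ℝ, coeffMoment E (temporal H Ψ₀ T) x y =
      c * ∫ t, Complex.exp (Complex.I * ω * (t : ℂ)) ∂((volume : Measure ℝ)[|Set.Icc 0 T]) := by
    intro T
    rw [coeffMoment, temporal, integral_map (continuous_evolve Ψ₀ hH).aemeasurable
      (continuous_coeff E x y).aestronglyMeasurable, ← integral_const_mul]
    congr 1
    ext t
    have hs : ∀ j, star (Complex.exp (-(Complex.I * (t : ℂ)) * e j)) =
        Complex.exp (Complex.I * t * e j) := fun j => by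
      rw [RCLike.star_def, ← Complex.exp_conj]
      simp
    simp_rw [inner_evolve Ψ₀ hH, star_mul', hs]
    have hω : Complex.I * ω * (t : ℂ) =
        ∑ i, (-(Complex.I * (t : ℂ)) * e (x i) + Complex.I * t * e (y i)) := by
      rw [Finset.sum_add_distrib, ← Finset.mul_sum, ← Finset.mul_sum]
      simp only [ω]
      push_cast
      ring
    rw [hω, Complex.exp_sum, ← Finset.prod_mul_distrib]
    refine Finset.prod_congr rfl fun i _ => ?_
    rw [Complex.exp_add]
    ring
  have hlim : coeffMoment E (randomPhase E Ψ₀) x y = c * (if ω = 0 then 1 else 0) := by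
    have hiff : ω = 0 ↔ occ x = occ y := by
      rw [occ_eq_iff, ← hk x y, sub_eq_zero, eq_comm]
    rw [coeffMoment_randomPhase]
    by_cases hxy : occ x = occ y
    · rw [if_pos hxy, if_pos (hiff.2 hxy), mul_one]
      simp only [c]
      rw [Finset.prod_mul_distrib,
        prod_comp_eq_prod_pow_occ (fun j => star (inner ℂ (E j) Ψ₀)) y,
        ← hxy, ← prod_comp_eq_prod_pow_occ (fun j => star (inner ℂ (E j) Ψ₀)) x,
        ← Finset.prod_mul_distrib]
      push_cast
      refine Finset.prod_congr rfl fun i _ => ?_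
      rw [RCLike.star_def, Complex.mul_conj, Complex.normSq_eq_norm_sq, pop]
    · rw [if_neg hxy, if_neg (mt hiff.1 hxy), mul_zero]
  simp_rw [h, hlim]
  exact (tendsto_integral_cond_exp ω).const_mul c

theorem tendsto_moment_temporal {Ψ₀ : Hilb D} (h₀ : ‖Ψ₀‖ = 1) (hH : IsEigensystem H E e)
    (hk : NoResonance k e) :
    Tendsto (fun T : ℝ => moment k (temporal H Ψ₀ T)) atTop
      (𝓝 (moment k (randomPhase E Ψ₀))) := by
  refine tendsto_pi_nhds.2 fun u => tendsto_pi_nhds.2 fun v => ?_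
  have hR := isPureStateEnsemble_randomPhase E h₀
  have := hR.isProbabilityMeasure
  rw [moment_eq_sum E (hR.norm_eq_one.mono fun _ h => h.le)]
  have h1 : ∀ᶠ T : ℝ in atTop,
      ∑ x, ∑ y, coeffMoment E (temporal H Ψ₀ T) x y * tensorVec E x u * star (tensorVec E y v) =
        moment k (temporal H Ψ₀ T) u v := by
    filter_upwards [eventually_gt_atTop 0] with T hT
    have hT' := isPureStateEnsemble_temporal h₀ hH hT
    have := hT'.isProbabilityMeasure
    rw [moment_eq_sum E (hT'.norm_eq_one.mono fun _ h => h.le)]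
  refine Tendsto.congr' h1 ?_
  exact tendsto_finsetSum _ fun x _ => tendsto_finsetSum _ fun y _ =>
    ((tendsto_coeffMoment_temporal Ψ₀ hH hk x y).mul_const _).mul_const _

end Temporal

/-! ### The diagonal state -/

section DiagonalState

variable {D : ℕ} (E : OrthonormalBasis (Fin D) ℂ (Hilb D)) (Ψ₀ : Hilb D)

lemma act_sigmaDiag (j : Fin D) : act (sigmaDiag E Ψ₀) (E j) = (pop E Ψ₀ j : ℂ) • E j := by
  apply WithLp.ofLp_injective 2
  rw [act, Matrix.ofLp_toEuclideanCLM, sigmaDiag, Matrix.sum_mulVec]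
  have h : ∀ i, Matrix.mulVec (((‖inner ℂ (E i) Ψ₀‖ ^ 2 : ℝ) : ℂ) •
      Matrix.vecMulVec (E i).ofLp (star (E i).ofLp)) (E j).ofLp =
      if i = j then (pop E Ψ₀ j : ℂ) • (E j).ofLp else 0 := by
    intro i
    have h1 : star (E i).ofLp ⬝ᵥ (E j).ofLp = if i = j then 1 else 0 := by
      rw [← E.inner_eq_ite, EuclideanSpace.inner_eq_star_dotProduct, dotProduct_comm]
    rw [Matrix.smul_mulVec, Matrix.vecMulVec_mulVec, h1]
    split_ifs with hij
    · subst hij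
      simp [pop]
    · simp
  simp_rw [h]
  simp

lemma isHermitian_sigmaDiag : (sigmaDiag E Ψ₀).IsHermitian := by
  rw [Matrix.IsHermitian, sigmaDiag, Matrix.conjTranspose_sum]
  refine Finset.sum_congr rfl fun j _ => ?_
  rw [Matrix.conjTranspose_smul, Matrix.conjTranspose_vecMulVec, star_star, RCLike.star_def,
    Complex.conj_ofReal]

open Polynomial in
/-- On the finite set consisting of the spectrum and the populations, the square root agrees with an
interpolation polynomial, so the functional calculus acts on the eigenvectors as expected. -/
lemma act_sqrt_sigmaDiag (j : Fin D) :
    act (cfc Real.sqrt (sigmaDiag E Ψ₀)) (E j) = (√(pop E Ψ₀ j) : ℂ) • E j := by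
  classical
  let s : Finset ℝ := (Matrix.finite_real_spectrum (A := sigmaDiag E Ψ₀)).toFinset ∪
    Finset.univ.image (pop E Ψ₀)
  let q : ℝ[X] := Lagrange.interpolate s id Real.sqrt
  have hq : ∀ a ∈ s, q.eval a = √a := fun a ha =>
    Lagrange.eval_interpolate_at_node (v := id) Real.sqrt (Function.injective_id.injOn) ha
  have h1 : cfc Real.sqrt (sigmaDiag E Ψ₀) = aeval (sigmaDiag E Ψ₀) q := by
    rw [← cfc_polynomial q (sigmaDiag E Ψ₀) (isHermitian_sigmaDiag E Ψ₀)]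
    exact cfc_congr fun a ha => (hq a (by simp [s, ha])).symm
  have h2 : ∀ r : ℝ[X], act (aeval (sigmaDiag E Ψ₀) r) (E j) =
      ((r.eval (pop E Ψ₀ j) : ℝ) : ℂ) • E j := by
    intro r
    induction r using Polynomial.induction_on' with
    | add p q hp hq =>
      have : act (aeval (sigmaDiag E Ψ₀) (p + q)) (E j) =
          act (aeval (sigmaDiag E Ψ₀) p) (E j) + act (aeval (sigmaDiag E Ψ₀) q) (E j) := by
        simp [act]
      rw [this, hp, hq, eval_add, Complex.ofReal_add, add_smul]
    | monomial n a =>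
      rw [aeval_monomial, eval_monomial, ← Algebra.smul_def]
      have h3 : act (a • sigmaDiag E Ψ₀ ^ n) (E j) = (a : ℂ) • act (sigmaDiag E Ψ₀ ^ n) (E j) := by
        have : a • sigmaDiag E Ψ₀ ^ n = (a : ℂ) • sigmaDiag E Ψ₀ ^ n := by
          ext; simp
        rw [this, act, map_smul, smul_apply]
        rfl
      rw [h3, act_pow_eigen (act_sigmaDiag E Ψ₀ j), smul_smul]
      push_cast
      rfl
  rw [h1, h2, hq]
  simp [s]

lemma inner_act_sqrt_sigmaDiag (φ : Hilb D) (j : Fin D) :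
    inner ℂ (E j) (act (cfc Real.sqrt (sigmaDiag E Ψ₀)) φ) =
      (√(pop E Ψ₀ j) : ℂ) * inner ℂ (E j) φ := by
  have h : act (cfc Real.sqrt (sigmaDiag E Ψ₀)) φ =
      ∑ i, ((√(pop E Ψ₀ i) : ℂ) * inner ℂ (E i) φ) • E i := by
    conv_lhs => rw [← E.sum_repr' φ]
    have h1 := act_sqrt_sigmaDiag E Ψ₀
    simp only [act] at h1 ⊢
    rw [map_sum]
    refine Finset.sum_congr rfl fun i _ => ?_
    rw [map_smul, h1, smul_smul, mul_comm]
  rw [h, E.orthonormal.inner_right_fintype]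

lemma norm_sq_act_sqrt_sigmaDiag (φ : Hilb D) :
    ‖act (cfc Real.sqrt (sigmaDiag E Ψ₀)) φ‖ ^ 2 = ∑ j, pop E Ψ₀ j * ‖inner ℂ (E j) φ‖ ^ 2 := by
  rw [← E.sum_sq_norm_inner_right]
  refine Finset.sum_congr rfl fun j _ => ?_
  rw [inner_act_sqrt_sigmaDiag, norm_mul, mul_pow, Complex.norm_real, Real.norm_eq_abs, sq_abs,
    Real.sq_sqrt (pop_nonneg E Ψ₀ j)]

lemma inner_act_sigmaDiag (φ : Hilb D) :
    (inner ℂ φ (act (sigmaDiag E Ψ₀) φ)).re = ∑ j, pop E Ψ₀ j * ‖inner ℂ (E j) φ‖ ^ 2 := by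
  have h : act (sigmaDiag E Ψ₀) φ = ∑ i, ((pop E Ψ₀ i : ℂ) * inner ℂ (E i) φ) • E i := by
    conv_lhs => rw [← E.sum_repr' φ]
    have h1 := act_sigmaDiag E Ψ₀
    simp only [act] at h1 ⊢
    rw [map_sum]
    refine Finset.sum_congr rfl fun i _ => ?_
    rw [map_smul, h1, smul_smul, mul_comm]
  rw [h, inner_sum, Complex.re_sum]
  refine Finset.sum_congr rfl fun j _ => ?_
  rw [inner_smul_right, ← inner_conj_symm φ (E j), mul_assoc, Complex.mul_conj,
    Complex.normSq_eq_norm_sq, ← Complex.ofReal_mul, Complex.ofReal_re]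

lemma schattenTwo_sigmaDiag : schattenTwo (sigmaDiag E Ψ₀) = √(∑ j, pop E Ψ₀ j ^ 2) := by
  have h1 : ∀ i j, star (E i).ofLp ⬝ᵥ (E j).ofLp = if i = j then (1 : ℂ) else 0 := by
    intro i j
    rw [← E.inner_eq_ite, EuclideanSpace.inner_eq_star_dotProduct, dotProduct_comm]
  have h : (sigmaDiag E Ψ₀)ᴴ * sigmaDiag E Ψ₀ =
      ∑ j, ((pop E Ψ₀ j ^ 2 : ℝ) : ℂ) • Matrix.vecMulVec (E j).ofLp (star (E j).ofLp) := by
    rw [isHermitian_sigmaDiag, sigmaDiag, Finset.sum_mul_sum]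
    refine Finset.sum_congr rfl fun i _ => ?_
    rw [Finset.sum_eq_single i]
    · rw [smul_mul_smul_comm, Matrix.vecMulVec_mul_vecMulVec, h1, if_pos rfl, one_smul,
        ← Complex.ofReal_mul, ← sq]
      rfl
    · intro j _ hj
      rw [smul_mul_smul_comm, Matrix.vecMulVec_mul_vecMulVec, h1, if_neg hj.symm, zero_smul,
        Matrix.vecMulVec_zero, smul_zero]
    · simp
  rw [schattenTwo, h, Matrix.trace_sum, Complex.re_sum]
  congr 1
  refine Finset.sum_congr rfl fun j _ => ?_
  rw [Matrix.trace_smul, Matrix.trace_vecMulVec, dotProduct_comm, h1, if_pos rfl, smul_eq_mul,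
    mul_one, Complex.ofReal_re]

lemma pop_le_schattenInf (j : Fin D) : pop E Ψ₀ j ≤ schattenInf (sigmaDiag E Ψ₀) := by
  have h := (Matrix.toEuclideanCLM (𝕜 := ℂ) (sigmaDiag E Ψ₀)).le_opNorm (E j)
  have h1 := act_sigmaDiag E Ψ₀ j
  rw [act] at h1
  rw [h1, norm_smul, E.norm_eq_one, mul_one, mul_one, Complex.norm_real,
    Real.norm_of_nonneg (pop_nonneg E Ψ₀ j)] at h
  exact h

variable {Ψ₀} in
/-- The largest eigenvalue of a state is at least `1 / D`. -/
lemma one_le_mul_schattenInf (h : ‖Ψ₀‖ = 1) : 1 ≤ (D : ℝ) * schattenInf (sigmaDiag E Ψ₀) := by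
  calc (1 : ℝ) = ∑ j, pop E Ψ₀ j := (sum_pop E h).symm
    _ ≤ ∑ _j : Fin D, schattenInf (sigmaDiag E Ψ₀) :=
        Finset.sum_le_sum fun j _ => pop_le_schattenInf E Ψ₀ j
    _ = _ := by simp

end DiagonalState

/-! ### Moments of the Scrooge ensemble -/

section ScroogeMoments

variable {D k : ℕ}

lemma integrable_haarState_of_continuous {f : Hilb D → ℝ} (hf : Continuous f) :
    Integrable f (haarState D) := by
  rcases Nat.eq_zero_or_pos D with rfl | hD
  · have : haarState 0 = 0 := by
      rw [haarState, (Measure.toSphere_eq_zero_iff (lebesgue 0)).2 inferInstance]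
      simp
    rw [this]
    exact integrable_zero_measure
  have : NeZero D := ⟨hD.ne'⟩
  have hc := (isCompact_sphere (0 : Hilb D) 1).exists_bound_of_continuousOn hf.continuousOn
  obtain ⟨C, hC⟩ := hc
  refine Integrable.of_bound hf.aestronglyMeasurable C ?_
  filter_upwards [ae_norm_haarState] with φ hφ
  exact hC φ (by simpa using hφ)

/-- The quadratic form `∑ⱼ pⱼ |φⱼ|²`. -/
noncomputable def weight (p : Fin D → ℝ) (φ : Hilb D) : ℝ := ∑ j, p j * ‖φ j‖ ^ 2

lemma weight_nonneg {p : Fin D → ℝ} (hp : ∀ j, 0 ≤ p j) (φ : Hilb D) : 0 ≤ weight p φ :=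
  Finset.sum_nonneg fun j _ => mul_nonneg (hp j) (sq_nonneg _)

@[fun_prop]
lemma continuous_weight (p : Fin D → ℝ) : Continuous (weight p) := by
  unfold weight
  fun_prop

/-- The density `D q` of the Scrooge ensemble times the normalization `q⁻ᵏ` of the `k`-th tensor
power of the projected state, where `q = weight p φ`. It vanishes where `q = 0`. -/
noncomputable def tilt (k : ℕ) (p : Fin D → ℝ) (φ : Hilb D) : ℝ :=
  D * weight p φ * ((weight p φ)⁻¹) ^ k

lemma tilt_nonneg {p : Fin D → ℝ} (hp : ∀ j, 0 ≤ p j) (φ : Hilb D) : 0 ≤ tilt k p φ := by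
  have := weight_nonneg hp φ
  unfold tilt
  positivity

lemma measurable_tilt (k : ℕ) (p : Fin D → ℝ) : Measurable (tilt k p) := by
  have := (continuous_weight p).measurable
  unfold tilt
  fun_prop

/-- The diagonal matrix elements of the `k`-th moment of `Scrooge(∑ pⱼ |Eⱼ⟩⟨Eⱼ|)` in the product
basis of `E`. -/
noncomputable def scroogeDiag (p : Fin D → ℝ) (x : Fin k → Fin D) : ℝ :=
  ∫ φ, tilt k p φ * ∏ i, (p (x i) * ‖φ (x i)‖ ^ 2) ∂haarState D

variable (E : OrthonormalBasis (Fin D) ℂ (Hilb D)) (Ψ₀ : Hilb D)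

lemma continuous_act (A : Matrix (Fin D) (Fin D) ℂ) : Continuous (act A) :=
  (Matrix.toEuclideanCLM (𝕜 := ℂ) A).continuous

lemma measurable_scroogeMap (A : Matrix (Fin D) (Fin D) ℂ) :
    Measurable fun φ => ((‖act A φ‖⁻¹ : ℝ) : ℂ) • act A φ := by
  have := (continuous_act A).measurable
  fun_prop

lemma measurable_scroogeDensity (A : Matrix (Fin D) (Fin D) ℂ) :
    Measurable fun φ : Hilb D => ENNReal.ofReal ((D : ℝ) * (inner ℂ φ (act A φ)).re) := by
  have h : Continuous fun φ : Hilb D => (inner ℂ φ (act A φ)).re :=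
    Complex.continuous_re.comp (continuous_id.inner (continuous_act A))
  have := h.measurable
  fun_prop

lemma norm_le_one_scrooge (A : Matrix (Fin D) (Fin D) ℂ) : ∀ᵐ ψ ∂scrooge A, ‖ψ‖ ≤ 1 := by
  rw [scrooge, ae_map_iff (measurable_scroogeMap _).aemeasurable
    (measurableSet_le (by fun_prop) (by fun_prop))]
  refine ae_of_all _ fun φ => ?_
  rw [norm_smul, Complex.norm_real, norm_inv, norm_norm]
  exact inv_mul_le_one

instance (A : Matrix (Fin D) (Fin D) ℂ) : IsFiniteMeasure (scrooge A) := by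
  have : IsFiniteMeasure ((haarState D).withDensity
      (fun φ => ENNReal.ofReal ((D : ℝ) * (inner ℂ φ (act A φ)).re))) := by
    refine isFiniteMeasure_withDensity_ofReal ?_
    refine (integrable_haarState_of_continuous ?_).2
    exact continuous_const.mul
      (Complex.continuous_re.comp (continuous_id.inner (continuous_act A)))
  rw [scrooge]
  infer_instance

lemma coeffMoment_scrooge_eq_integral (x y : Fin k → Fin D) :
    coeffMoment E (scrooge (sigmaDiag E Ψ₀)) x y =
      ∫ φ, (tilt k (pop E Ψ₀) φ : ℂ) *
        ∏ i, ((√(pop E Ψ₀ (x i)) : ℂ) * φ (x i) * ((√(pop E Ψ₀ (y i)) : ℂ) * star (φ (y i))))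
        ∂haarState D := by
  rw [coeffMoment, scrooge, integral_map (measurable_scroogeMap _).aemeasurable
    (continuous_coeff E x y).aestronglyMeasurable,
    integral_withDensity_eq_integral_toReal_smul (measurable_scroogeDensity _)
      (ae_of_all _ fun _ => ENNReal.ofReal_lt_top)]
  refine Eq.trans ?_ ((measurePreserving_haarState E.repr).integral_comp
    E.repr.toHomeomorph.measurableEmbedding _)
  congr 1
  ext φ
  have hq : weight (pop E Ψ₀) (E.repr φ) = ∑ j, pop E Ψ₀ j * ‖inner ℂ (E j) φ‖ ^ 2 := by
    simp only [weight, E.repr_apply_apply]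
  have hq0 := weight_nonneg (pop_nonneg E Ψ₀) (E.repr φ)
  have hn : ‖act (cfc Real.sqrt (sigmaDiag E Ψ₀)) φ‖ = √(weight (pop E Ψ₀) (E.repr φ)) := by
    rw [hq, ← norm_sq_act_sqrt_sigmaDiag, Real.sqrt_sq (norm_nonneg _)]
  rw [inner_act_sigmaDiag, ← hq, ENNReal.toReal_ofReal (by positivity), hn, tilt]
  set q := weight (pop E Ψ₀) (E.repr φ)
  have hs : ((√q)⁻¹ : ℝ) * ((√q)⁻¹ : ℝ) = q⁻¹ := by
    rw [← mul_inv, Real.mul_self_sqrt hq0]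
  have hp : ∏ i, (inner ℂ (E (x i)) ((((√q)⁻¹ : ℝ) : ℂ) • act (cfc Real.sqrt (sigmaDiag E Ψ₀)) φ) *
      star (inner ℂ (E (y i)) ((((√q)⁻¹ : ℝ) : ℂ) • act (cfc Real.sqrt (sigmaDiag E Ψ₀)) φ))) =
      ∏ i, (((q⁻¹ : ℝ) : ℂ) * ((√(pop E Ψ₀ (x i)) : ℂ) * (E.repr φ) (x i) *
        ((√(pop E Ψ₀ (y i)) : ℂ) * star ((E.repr φ) (y i))))) := by
    refine Finset.prod_congr rfl fun i _ => ?_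
    rw [inner_smul_right, inner_smul_right, inner_act_sqrt_sigmaDiag, inner_act_sqrt_sigmaDiag,
      E.repr_apply_apply, E.repr_apply_apply, ← hs]
    simp only [star_mul', RCLike.star_def, Complex.conj_ofReal]
    push_cast
    ring
  rw [hp, Finset.prod_mul_distrib, Finset.prod_const, Finset.card_univ, Fintype.card_fin]
  rw [Complex.real_smul]
  push_cast
  ring

/-- The linear isometry that multiplies the `j`-th coordinate by the phase `c`. -/
noncomputable def phaseShift (j : Fin D) (c : Circle) : Hilb D ≃ₗᵢ[ℂ] Hilb D :=
  LinearIsometryEquiv.piLpCongrRight 2 fun i =>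
    { LinearEquiv.smulOfNeZero ℂ ℂ ((if i = j then c else 1 : Circle) : ℂ) (Circle.coe_ne_zero _) with
      norm_map' := fun z => by
        change ‖((if i = j then c else 1 : Circle) : ℂ) * z‖ = ‖z‖
        rw [norm_mul, Circle.norm_coe, one_mul] }

lemma phaseShift_apply (j : Fin D) (c : Circle) (φ : Hilb D) (i : Fin D) :
    phaseShift j c φ i = ((if i = j then c else 1 : Circle) : ℂ) * φ i := rfl

lemma prod_phase (j : Fin D) (c : Circle) (x : Fin k → Fin D) :
    ∏ i, ((if x i = j then c else 1 : Circle) : ℂ) = (c : ℂ) ^ occ x j := by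
  rw [prod_comp_eq_prod_pow_occ (fun i => ((if i = j then c else 1 : Circle) : ℂ)) x,
    Finset.prod_eq_single j] <;> simp +contextual

/-- A diagonal phase acts on the off-diagonal matrix elements by a character, which is nontrivial
when the occupation numbers differ. -/
lemma coeffMoment_scrooge_of_ne {x y : Fin k → Fin D} (h : occ x ≠ occ y) :
    coeffMoment E (scrooge (sigmaDiag E Ψ₀)) x y = 0 := by
  rw [coeffMoment_scrooge_eq_integral]
  obtain ⟨j, hj⟩ := Function.ne_iff.1 h
  set f : Hilb D → ℂ := fun φ => (tilt k (pop E Ψ₀) φ : ℂ) *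
        ∏ i, ((√(pop E Ψ₀ (x i)) : ℂ) * φ (x i) * ((√(pop E Ψ₀ (y i)) : ℂ) * star (φ (y i))))
  set m : ℤ := (occ x j : ℤ) - occ y j
  have hm : (m : ℝ) ≠ 0 := by
    rw [Int.cast_ne_zero]
    omega
  -- The angle is chosen such that the character takes the value `-1`.
  set c : Circle := Circle.exp (Real.pi / m)
  have hc : (c : ℂ) ^ occ x j * star (c : ℂ) ^ occ y j = -1 := by
    have h1 : star (c : ℂ) = (c : ℂ)⁻¹ := by
      rw [← Circle.coe_inv, Circle.coe_inv_eq_conj]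
      rfl
    have h2 : c ^ m = Circle.exp Real.pi := by
      rw [← Circle.exp_intCast_mul]
      congr 1
      field_simp
    rw [h1, inv_pow, ← div_eq_mul_inv, ← zpow_natCast, ← zpow_natCast,
      ← zpow_sub₀ c.coe_ne_zero, ← Circle.coe_zpow]
    change ((c ^ m : Circle) : ℂ) = -1
    rw [h2, Circle.coe_exp, Complex.exp_pi_mul_I]
  have hf : ∀ φ, f (phaseShift j c φ) = -f φ := by
    intro φ
    have ht : tilt k (pop E Ψ₀) (phaseShift j c φ) = tilt k (pop E Ψ₀) φ := by
      simp only [tilt, weight, phaseShift_apply, norm_mul, Circle.norm_coe, one_mul]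
    have hs : ∀ i, star (((if y i = j then c else 1 : Circle) : ℂ) * φ (y i)) =
        star ((if y i = j then c else 1 : Circle) : ℂ) * star (φ (y i)) := fun i => star_mul' _ _
    simp only [f, ht, phaseShift_apply, hs]
    rw [← mul_neg]
    congr 1
    rw [← neg_one_mul, ← hc, ← prod_phase j c x, ← star_pow, ← prod_phase j c y, star_prod,
      ← Finset.prod_mul_distrib, ← Finset.prod_mul_distrib]
    refine Finset.prod_congr rfl fun i _ => ?_
    ring
  have h1 := (measurePreserving_haarState (phaseShift j c)).integral_comp
    (phaseShift j c).toHomeomorph.measurableEmbedding f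
  simp_rw [hf] at h1
  rw [integral_neg] at h1
  exact self_eq_neg.1 h1.symm

lemma coeffMoment_scrooge (x y : Fin k → Fin D) :
    coeffMoment E (scrooge (sigmaDiag E Ψ₀)) x y =
      if occ x = occ y then (scroogeDiag (pop E Ψ₀) x : ℂ) else 0 := by
  split_ifs with h
  · rw [coeffMoment_scrooge_eq_integral, scroogeDiag, ← integral_complex_ofReal]
    congr 1
    ext φ
    push_cast
    congr 1
    rw [Finset.prod_mul_distrib,
      prod_comp_eq_prod_pow_occ (fun j => (√(pop E Ψ₀ j) : ℂ) * star (φ j)) y, ← h,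
      ← prod_comp_eq_prod_pow_occ (fun j => (√(pop E Ψ₀ j) : ℂ) * star (φ j)) x,
      ← Finset.prod_mul_distrib]
    refine Finset.prod_congr rfl fun i _ => ?_
    have h1 : ((√(pop E Ψ₀ (x i)) : ℝ) : ℂ) * ((√(pop E Ψ₀ (x i)) : ℝ) : ℂ) = pop E Ψ₀ (x i) := by
      rw [← Complex.ofReal_mul, Real.mul_self_sqrt (pop_nonneg E Ψ₀ _)]
    have h2 : φ (x i) * star (φ (x i)) = (‖φ (x i)‖ : ℂ) ^ 2 := by
      rw [RCLike.star_def, Complex.mul_conj, Complex.normSq_eq_norm_sq]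
      push_cast
      rfl
    rw [← h1, ← h2]
    ring
  · exact coeffMoment_scrooge_of_ne E Ψ₀ h

lemma scroogeDiag_eq_of_occ_eq (p : Fin D → ℝ) {x y : Fin k → Fin D} (h : occ x = occ y) :
    scroogeDiag p x = scroogeDiag p y := by
  simp only [scroogeDiag]
  congr 1
  ext φ
  rw [prod_comp_eq_prod_pow_occ (fun j => p j * ‖φ j‖ ^ 2) x, h,
    ← prod_comp_eq_prod_pow_occ (fun j => p j * ‖φ j‖ ^ 2) y]

end ScroogeMoments

/-! ### Scrooge probabilities against product probabilities -/

section Comparison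

variable {D k : ℕ}

/-- The tangent-line bound for the convex function `u ↦ u⁻ᵐ` at `u = 1`. -/
lemma pow_mul_tangent_le_one {u : ℝ} (hu : 0 ≤ u) (m : ℕ) : u ^ m * (1 + m - m * u) ≤ 1 := by
  induction m with
  | zero => simp
  | succ m ih =>
    have h : 0 ≤ (m + 1) * u ^ m * (u - 1) ^ 2 := by positivity
    push_cast
    rw [pow_succ]
    nlinarith [h, ih]

lemma le_tilt_mul_prod [NeZero D] {p : Fin D → ℝ} (hp : ∀ j, 0 ≤ p j) (hk : 1 ≤ k)
    (x : Fin k → Fin D) (φ : Hilb D) :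
    (D : ℝ) ^ k * (k * (∏ i, (p (x i) * ‖φ (x i)‖ ^ 2)) -
        (k - 1) * D * ((∏ i, (p (x i) * ‖φ (x i)‖ ^ 2)) * weight p φ)) ≤
      tilt k p φ * ∏ i, (p (x i) * ‖φ (x i)‖ ^ 2) := by
  set Q := ∏ i, (p (x i) * ‖φ (x i)‖ ^ 2)
  have hQ : 0 ≤ Q := Finset.prod_nonneg fun i _ => mul_nonneg (hp _) (sq_nonneg _)
  have hD : (0 : ℝ) < D := Nat.cast_pos.2 (NeZero.pos D)
  rcases (weight_nonneg hp φ).eq_or_lt with h0 | h0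
  · -- If the weight vanishes, then so does each factor of `Q`.
    have h1 : p (x ⟨0, hk⟩) * ‖φ (x ⟨0, hk⟩)‖ ^ 2 = 0 :=
      (Finset.sum_eq_zero_iff_of_nonneg fun j _ => mul_nonneg (hp j) (sq_nonneg _)).1 h0.symm _
        (Finset.mem_univ _)
    have h2 : Q = 0 := Finset.prod_eq_zero (Finset.mem_univ (⟨0, hk⟩ : Fin k)) h1
    simp [h2]
  · obtain ⟨m, rfl⟩ : ∃ m, k = m + 1 := ⟨k - 1, by omega⟩
    have h1 := pow_mul_tangent_le_one (mul_pos hD h0).le m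
    set q := weight p φ
    have h2 : (D : ℝ) ^ (m + 1) * ((m + 1 : ℝ) - m * (D * q)) ≤ tilt (m + 1) p φ := by
      have h3 : tilt (m + 1) p φ = D / q ^ m := by
        change (D : ℝ) * q * q⁻¹ ^ (m + 1) = _
        rw [inv_pow, pow_succ]
        field_simp
      rw [h3, le_div_iff₀ (by positivity)]
      rw [mul_pow] at h1
      calc (D : ℝ) ^ (m + 1) * ((m + 1 : ℝ) - m * (D * q)) * q ^ m
          = D * ((D : ℝ) ^ m * q ^ m * (1 + m - m * (D * q))) := by ring
        _ ≤ D * 1 := by gcongr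
        _ = D := mul_one _
    calc _ = (D : ℝ) ^ (m + 1) * ((m + 1 : ℝ) - m * (D * q)) * Q := by push_cast; ring
      _ ≤ _ := by gcongr

lemma sum_tilt_mul_prod (p : Fin D → ℝ) (φ : Hilb D) :
    ∑ x : Fin k → Fin D, tilt k p φ * ∏ i, (p (x i) * ‖φ (x i)‖ ^ 2) = D * weight p φ := by
  rw [← Finset.mul_sum, sum_word_prod fun _ j => p j * ‖φ j‖ ^ 2, Finset.prod_const,
    Finset.card_univ, Fintype.card_fin]
  change D * weight p φ * (weight p φ)⁻¹ ^ k * weight p φ ^ k = _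
  rcases eq_or_ne (weight p φ) 0 with h | h
  · simp [h]
  · rw [mul_assoc, ← mul_pow, inv_mul_cancel₀ h, one_pow, mul_one]

lemma integrable_tilt_mul_prod {p : Fin D → ℝ} (hp : ∀ j, 0 ≤ p j)
    (x : Fin k → Fin D) :
    Integrable (fun φ => tilt k p φ * ∏ i, (p (x i) * ‖φ (x i)‖ ^ 2)) (haarState D) := by
  have hm : Continuous fun φ : Hilb D => ∏ i, (p (x i) * ‖φ (x i)‖ ^ 2) := by fun_prop
  refine Integrable.mono' (g := fun φ => D * weight p φ)
    (integrable_haarState_of_continuous (by fun_prop))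
    ((measurable_tilt k p).mul hm.measurable).aestronglyMeasurable (ae_of_all _ fun φ => ?_)
  have hnn : ∀ x : Fin k → Fin D, 0 ≤ tilt k p φ * ∏ i, (p (x i) * ‖φ (x i)‖ ^ 2) := fun x =>
    mul_nonneg (tilt_nonneg hp φ)
      (Finset.prod_nonneg fun _ _ => mul_nonneg (hp _) (sq_nonneg _))
  rw [Real.norm_of_nonneg (hnn x), ← sum_tilt_mul_prod p]
  exact Finset.single_le_sum (f := fun x : Fin k → Fin D =>
    tilt k p φ * ∏ i, (p (x i) * ‖φ (x i)‖ ^ 2)) (fun x _ => hnn x) (Finset.mem_univ x)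

lemma scroogeDiag_nonneg {p : Fin D → ℝ} (hp : ∀ j, 0 ≤ p j) (x : Fin k → Fin D) :
    0 ≤ scroogeDiag p x :=
  integral_nonneg fun φ => mul_nonneg (tilt_nonneg hp φ)
    (Finset.prod_nonneg fun _ _ => mul_nonneg (hp _) (sq_nonneg _))

lemma integral_prod_norm_sq [NeZero D] (x : Fin k → Fin D) :
    ∫ φ, ∏ i, ‖φ (x i)‖ ^ 2 ∂haarState D =
      (∏ j, ((occ x j).factorial : ℝ)) / D.ascFactorial k := by
  have h := integral_haarState_monomial (occ x)
  rw [sum_occ] at h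
  rw [← h]
  congr 1
  ext φ
  rw [prod_comp_eq_prod_pow_occ (fun j => ‖φ j‖ ^ 2)]
  simp_rw [pow_mul]

lemma integral_prod_norm_sq_mul [NeZero D] (x : Fin k → Fin D) (j : Fin D) :
    ∫ φ, (∏ i, ‖φ (x i)‖ ^ 2) * ‖φ j‖ ^ 2 ∂haarState D =
      (∏ j, ((occ x j).factorial : ℝ)) / D.ascFactorial k * ((occ x j + 1) / (D + k)) := by
  have h := integral_haarState_monomial (occ x + Pi.single j 1)
  have h1 : ∑ i, (occ x + Pi.single j 1 : Fin D → ℕ) i = k + 1 := by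
    simp [Finset.sum_add_distrib, sum_occ]
  have h2 : ∏ i, (((occ x + Pi.single j 1 : Fin D → ℕ) i).factorial : ℝ) =
      (∏ i, ((occ x i).factorial : ℝ)) * (occ x j + 1) := by
    rw [← Finset.mul_prod_erase _ _ (Finset.mem_univ j),
      ← Finset.mul_prod_erase _ (fun i => ((occ x i).factorial : ℝ)) (Finset.mem_univ j)]
    have : ∀ i ∈ Finset.univ.erase j,
        (((occ x + Pi.single j 1 : Fin D → ℕ) i).factorial : ℝ) = (occ x i).factorial := by
      intro i hi
      simp [Finset.ne_of_mem_erase hi]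
    rw [Finset.prod_congr rfl this]
    simp only [Pi.add_apply, Pi.single_eq_same, Nat.factorial_succ]
    push_cast
    ring
  rw [h1, h2, Nat.ascFactorial_succ] at h
  have h3 : ∀ φ : Hilb D, (∏ i, ‖φ (x i)‖ ^ 2) * ‖φ j‖ ^ 2 =
      ∏ i, ‖φ i‖ ^ (2 * (occ x + Pi.single j 1 : Fin D → ℕ) i) := by
    intro φ
    rw [prod_comp_eq_prod_pow_occ (fun j => ‖φ j‖ ^ 2)]
    simp only [Pi.add_apply, mul_add, pow_add, Finset.prod_mul_distrib, pow_mul]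
    congr 1
    rw [Finset.prod_eq_single j] <;> simp +contextual
  simp_rw [h3, h]
  push_cast
  rw [div_mul_div_comm, mul_comm ((D : ℝ) + k)]

lemma sum_scroogeDiag [NeZero D] {p : Fin D → ℝ} (hp : ∀ j, 0 ≤ p j) (hp1 : ∑ j, p j = 1) :
    ∑ x : Fin k → Fin D, scroogeDiag p x = 1 := by
  simp only [scroogeDiag]
  rw [← integral_finsetSum _ fun x _ => integrable_tilt_mul_prod hp x]
  simp_rw [sum_tilt_mul_prod p]
  have hD : (D : ℝ) ≠ 0 := Nat.cast_ne_zero.2 (NeZero.ne D)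
  have h1 : ∀ j : Fin D, ∫ φ, ‖φ j‖ ^ 2 ∂haarState D = (D : ℝ)⁻¹ := by
    intro j
    have := integral_prod_norm_sq_mul (k := 0) (Fin.elim0 : Fin 0 → Fin D) j
    simpa [occ] using this
  rw [integral_const_mul]
  simp only [weight]
  rw [integral_finsetSum _ fun j _ => integrable_haarState_of_continuous (by fun_prop)]
  simp_rw [integral_const_mul, h1]
  rw [← Finset.sum_mul, hp1, one_mul, mul_inv_cancel₀ hD]

lemma one_sub_le_pow_div_ascFactorial [NeZero D] (k : ℕ) :
    1 - (k : ℝ) ^ 2 / D ≤ (D : ℝ) ^ k / D.ascFactorial k ∧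
      (D : ℝ) ^ k / D.ascFactorial k ≤ 1 := by
  have hD : (0 : ℝ) < D := Nat.cast_pos.2 (NeZero.pos D)
  induction k with
  | zero => simp
  | succ k ih =>
    have hrec : (D : ℝ) ^ (k + 1) / D.ascFactorial (k + 1) =
        (D : ℝ) ^ k / D.ascFactorial k * (D / (D + k)) := by
      rw [Nat.ascFactorial_succ, pow_succ, div_mul_div_comm]
      push_cast
      rw [mul_comm ((D : ℝ) + k)]
    have h1 : D / (D + k : ℝ) ≤ 1 := by
      rw [div_le_one (by positivity)]
      linarith [(Nat.cast_nonneg k : (0 : ℝ) ≤ k)]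
    have h2 : 1 - (k : ℝ) / D ≤ D / (D + k : ℝ) := by
      rw [le_div_iff₀ (by positivity)]
      have : (1 - (k : ℝ) / D) * (D + k) = D - (k : ℝ) ^ 2 / D := by
        field_simp
        ring
      rw [this]
      linarith [show 0 ≤ (k : ℝ) ^ 2 / D by positivity]
    have h0 : 0 ≤ (D : ℝ) ^ k / D.ascFactorial k := by positivity
    rw [hrec]
    refine ⟨?_, mul_le_one₀ ih.2 (by positivity) h1⟩
    have h3 : ((k + 1 : ℕ) : ℝ) ^ 2 / D = (k : ℝ) ^ 2 / D + (2 * k + 1) / D := by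
      push_cast
      ring
    have h4 : (k : ℝ) / D ≤ (2 * k + 1) / D := by
      gcongr
      linarith [(Nat.cast_nonneg k : (0 : ℝ) ≤ k)]
    nlinarith [mul_nonneg h0 (sub_nonneg.2 h2), mul_nonneg (sub_nonneg.2 ih.2)
      (show 0 ≤ (k : ℝ) / D by positivity), ih.1]

/-- The one-sided comparison of the product distribution with the Scrooge distribution on words.
Integrating the tangent-line bound only involves the Haar moments of order `k` and `k + 1`. -/
lemma prod_sub_scroogeDiag_le [NeZero D] {p : Fin D → ℝ} (hp : ∀ j, 0 ≤ p j)
    (hp1 : ∑ j, p j = 1) (hk : 1 ≤ k) (x : Fin k → Fin D) :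
    ∏ i, p (x i) - scroogeDiag p x ≤
      (∏ i, p (x i)) * ((k : ℝ) ^ 2 / D + (k - 1) * ∑ i, p (x i)) := by
  have hD : (0 : ℝ) < D := Nat.cast_pos.2 (NeZero.pos D)
  set P := ∏ i, p (x i)
  set s := ∑ i, p (x i)
  set N : ℝ := ∏ j, ((occ x j).factorial : ℝ)
  set a : ℝ := (D : ℝ) ^ k / D.ascFactorial k
  have hP : 0 ≤ P := Finset.prod_nonneg fun i _ => hp _
  have hs : 0 ≤ s := Finset.sum_nonneg fun i _ => hp _
  have hk1 : (0 : ℝ) ≤ k - 1 := by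
    have : (1 : ℝ) ≤ k := by exact_mod_cast hk
    linarith
  have hN : 1 ≤ N := by
    have : 1 ≤ ∏ j, (occ x j).factorial := Finset.prod_pos fun j _ => Nat.factorial_pos _
    simp only [N]
    exact_mod_cast this
  obtain ⟨ha1, ha2⟩ := one_sub_le_pow_div_ascFactorial (D := D) k
  have ha0 : 0 ≤ a := by positivity
  have hint : P * (N * a * (k - (k - 1) * (D / (D + k)) * (1 + s))) ≤ scroogeDiag p x := by
    have h1 : ∀ φ : Hilb D, ∏ i, (p (x i) * ‖φ (x i)‖ ^ 2) = P * ∏ i, ‖φ (x i)‖ ^ 2 := fun φ =>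
      Finset.prod_mul_distrib
    have hI1 : ∫ φ, ∏ i, (p (x i) * ‖φ (x i)‖ ^ 2) ∂haarState D =
        P * (N / D.ascFactorial k) := by
      simp_rw [h1]
      rw [integral_const_mul, integral_prod_norm_sq]
    have hI2 : ∫ φ, (∏ i, (p (x i) * ‖φ (x i)‖ ^ 2)) * weight p φ ∂haarState D =
        P * (N / D.ascFactorial k * ((1 + s) / (D + k))) := by
      have h2 : ∀ φ : Hilb D, (∏ i, (p (x i) * ‖φ (x i)‖ ^ 2)) * weight p φ =
          ∑ j, (P * p j) * ((∏ i, ‖φ (x i)‖ ^ 2) * ‖φ j‖ ^ 2) := by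
        intro φ
        rw [h1, weight, Finset.mul_sum]
        refine Finset.sum_congr rfl fun j _ => ?_
        ring
      simp_rw [h2]
      rw [integral_finsetSum _ fun j _ => integrable_haarState_of_continuous (by fun_prop)]
      simp_rw [integral_const_mul, integral_prod_norm_sq_mul]
      have h3 : ∑ j, p j * ((occ x j : ℝ) + 1) = 1 + s := by
        simp_rw [mul_add, mul_one, Finset.sum_add_distrib, hp1, mul_comm (p _)]
        rw [sum_occ_mul, add_comm]
      rw [← h3, Finset.sum_div, Finset.mul_sum, Finset.mul_sum]
      refine Finset.sum_congr rfl fun j _ => ?_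
      ring
    have hc : Continuous fun φ : Hilb D => ∏ i, (p (x i) * ‖φ (x i)‖ ^ 2) := by fun_prop
    have hc' : Continuous fun φ : Hilb D =>
        (∏ i, (p (x i) * ‖φ (x i)‖ ^ 2)) * weight p φ := by fun_prop
    have hi1 := (integrable_haarState_of_continuous hc).const_mul (k : ℝ)
    have hi2 := (integrable_haarState_of_continuous hc').const_mul (((k : ℝ) - 1) * D)
    have h := integral_mono ((hi1.sub hi2).const_mul ((D : ℝ) ^ k))
      (integrable_tilt_mul_prod hp x) (le_tilt_mul_prod hp hk x)
    simp only [Pi.sub_apply] at h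
    rw [integral_const_mul, integral_sub hi1 hi2, integral_const_mul, integral_const_mul, hI1,
      hI2] at h
    refine le_trans (le_of_eq ?_) h
    simp only [a]
    ring
  have hS := scroogeDiag_nonneg hp x
  have h1 : D / (D + k : ℝ) ≤ 1 := by
    rw [div_le_one (by positivity)]
    linarith [(Nat.cast_nonneg k : (0 : ℝ) ≤ k)]
  set b : ℝ := k - (k - 1) * (D / (D + k)) * (1 + s)
  have hb : 1 - (k - 1) * s ≤ b := by
    have : (k - 1) * (D / (D + k)) * (1 + s) ≤ (k - 1) * 1 * (1 + s) := by gcongr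
    simp only [b]
    linarith
  have hks : 0 ≤ (k - 1) * s := mul_nonneg hk1 hs
  have hkD : 0 ≤ (k : ℝ) ^ 2 / D := by positivity
  rcases le_total ((k - 1) * s) 1 with h | h
  · have h2 : 1 - ((k : ℝ) ^ 2 / D + (k - 1) * s) ≤ N * a * b := by
      have h3 : a * (1 - (k - 1) * s) ≤ N * a * b := by
        calc a * (1 - (k - 1) * s) ≤ a * b := by gcongr
          _ ≤ N * (a * b) := le_mul_of_one_le_left (mul_nonneg ha0 (by linarith)) hN
          _ = _ := by ring
      nlinarith [mul_nonneg (sub_nonneg.2 ha2) hks]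
    nlinarith [mul_le_mul_of_nonneg_left h2 hP]
  · have h2 : P * 1 ≤ P * ((k : ℝ) ^ 2 / D + (k - 1) * s) := by
      gcongr
      linarith
    linarith

lemma sum_prod_mul_sum (p : Fin D → ℝ) (hp1 : ∑ j, p j = 1) :
    ∑ x : Fin k → Fin D, (∏ i, p (x i)) * ∑ i, p (x i) = k * ∑ j, p j ^ 2 := by
  simp_rw [Finset.mul_sum]
  rw [Finset.sum_comm]
  have h : ∀ i : Fin k, ∑ x : Fin k → Fin D, (∏ l, p (x l)) * p (x i) = ∑ j, p j ^ 2 := by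
    intro i
    have h1 : ∀ x : Fin k → Fin D, (∏ l, p (x l)) * p (x i) =
        ∏ l, (p (x l) * if l = i then p (x l) else 1) := fun x => by
      rw [Finset.prod_mul_distrib]
      simp
    simp_rw [h1]
    rw [sum_word_prod fun l j => p j * if l = i then p j else 1, Finset.prod_eq_single i]
    · simp [sq]
    · intro l _ hl
      simp [hl, hp1]
    · simp
  simp_rw [h]
  rw [Finset.sum_const, Finset.card_univ, Fintype.card_fin, nsmul_eq_mul, Finset.mul_sum]

/-- Twice the total variation distance between the two distributions on words. As both have total
mass one, only the positive part of the difference has to be estimated. -/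
lemma sum_abs_prod_sub_scroogeDiag_le [NeZero D] {p : Fin D → ℝ} (hp : ∀ j, 0 ≤ p j)
    (hp1 : ∑ j, p j = 1) (hk : 1 ≤ k) :
    ∑ x : Fin k → Fin D, |∏ i, p (x i) - scroogeDiag p x| ≤
      2 * ((k : ℝ) ^ 2 / D + (k : ℝ) ^ 2 * ∑ j, p j ^ 2) := by
  have hk1 : (0 : ℝ) ≤ k - 1 := by
    have : (1 : ℝ) ≤ k := by exact_mod_cast hk
    linarith
  have hsum : ∑ x : Fin k → Fin D, ∏ i, p (x i) = 1 := by
    rw [sum_word_prod fun _ j => p j]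
    simp [hp1]
  have h1 : ∀ x : Fin k → Fin D, |∏ i, p (x i) - scroogeDiag p x| ≤
      2 * ((∏ i, p (x i)) * ((k : ℝ) ^ 2 / D + (k - 1) * ∑ i, p (x i))) -
        (∏ i, p (x i) - scroogeDiag p x) := by
    intro x
    have h := prod_sub_scroogeDiag_le hp hp1 hk x
    have h0 : 0 ≤ (∏ i, p (x i)) * ((k : ℝ) ^ 2 / D + (k - 1) * ∑ i, p (x i)) :=
      mul_nonneg (Finset.prod_nonneg fun i _ => hp _)
        (add_nonneg (by positivity) (mul_nonneg hk1 (Finset.sum_nonneg fun i _ => hp _)))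
    rw [abs_le]
    constructor <;> linarith
  refine (Finset.sum_le_sum fun x _ => h1 x).trans ?_
  rw [Finset.sum_sub_distrib, Finset.sum_sub_distrib, hsum, sum_scroogeDiag hp hp1, sub_self,
    sub_zero, ← Finset.mul_sum]
  simp_rw [mul_add]
  rw [Finset.sum_add_distrib, ← Finset.sum_mul, hsum]
  have h2 : ∑ x : Fin k → Fin D, (∏ i, p (x i)) * ((k - 1) * ∑ i, p (x i)) =
      (k - 1) * (k * ∑ j, p j ^ 2) := by
    rw [← sum_prod_mul_sum p hp1, Finset.mul_sum]
    refine Finset.sum_congr rfl fun x _ => ?_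
    ring
  rw [h2]
  have h3 : 0 ≤ (k : ℝ) * ∑ j, p j ^ 2 := by positivity
  nlinarith

end Comparison

/-! ### Trace distance between the ensembles -/

section Distance

variable {D k : ℕ} (E : OrthonormalBasis (Fin D) ℂ (Hilb D)) {Ψ₀ : Hilb D}

lemma moment_randomPhase_sub_scrooge (h₀ : ‖Ψ₀‖ = 1) (u v : Fin k → Fin D) :
    (moment k (randomPhase E Ψ₀) - moment k (scrooge (sigmaDiag E Ψ₀))) u v =
      ∑ x, ∑ y, (if occ x = occ y then
        ((∏ i, pop E Ψ₀ (x i) - scroogeDiag (pop E Ψ₀) x : ℝ) : ℂ) else 0) *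
        tensorVec E x u * star (tensorVec E y v) := by
  have hR := isPureStateEnsemble_randomPhase E h₀
  have := hR.isProbabilityMeasure
  rw [Matrix.sub_apply, moment_eq_sum E (hR.norm_eq_one.mono fun _ h => h.le),
    moment_eq_sum E (norm_le_one_scrooge _), ← Finset.sum_sub_distrib]
  refine Finset.sum_congr rfl fun x _ => ?_
  rw [← Finset.sum_sub_distrib]
  refine Finset.sum_congr rfl fun y _ => ?_
  rw [coeffMoment_randomPhase, coeffMoment_scrooge]
  split_ifs
  · push_cast
    ring
  · simp

lemma neZero_of_norm_eq_one (h₀ : ‖Ψ₀‖ = 1) : NeZero D := by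
  refine ⟨?_⟩
  rintro rfl
  rw [Subsingleton.elim Ψ₀ 0, norm_zero] at h₀
  exact zero_ne_one h₀

lemma half_schattenOne_le (h₀ : ‖Ψ₀‖ = 1) (hk : 1 ≤ k)
    (hs : (k : ℝ) ^ 2 * schattenTwo (sigmaDiag E Ψ₀) ≤ 1) :
    (1 / 2 : ℝ) * schattenOne
        (moment k (randomPhase E Ψ₀) - moment k (scrooge (sigmaDiag E Ψ₀))) ≤
      ((D : ℝ) * schattenInf (sigmaDiag E Ψ₀)) ^ k * ((k : ℝ) ^ 2 / (D : ℝ)) +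
        (k : ℝ) * schattenTwo (sigmaDiag E Ψ₀) := by
  have := neZero_of_norm_eq_one h₀
  have h1 := schattenOne_le_sum_abs_of_blocks _ (tensorVec E) (orthonormal_tensorVec E) occ
    (fun x => ∏ i, pop E Ψ₀ (x i) - scroogeDiag (pop E Ψ₀) x)
    (fun x y h => by
      rw [prod_comp_eq_prod_pow_occ (pop E Ψ₀) x, h, ← prod_comp_eq_prod_pow_occ (pop E Ψ₀) y,
        scroogeDiag_eq_of_occ_eq _ h])
    (moment_randomPhase_sub_scrooge E h₀ (k := k))
  have h2 := sum_abs_prod_sub_scroogeDiag_le (pop_nonneg E Ψ₀) (sum_pop E h₀) hk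
  have h3 : ∑ j, pop E Ψ₀ j ^ 2 = schattenTwo (sigmaDiag E Ψ₀) ^ 2 := by
    rw [schattenTwo_sigmaDiag, Real.sq_sqrt (Finset.sum_nonneg fun j _ => sq_nonneg _)]
  have h4 : (k : ℝ) ^ 2 / D ≤
      ((D : ℝ) * schattenInf (sigmaDiag E Ψ₀)) ^ k * ((k : ℝ) ^ 2 / (D : ℝ)) :=
    le_mul_of_one_le_left (by positivity) (one_le_pow₀ (one_le_mul_schattenInf E h₀))
  have h5 : (k : ℝ) ^ 2 * schattenTwo (sigmaDiag E Ψ₀) ^ 2 ≤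
      k * schattenTwo (sigmaDiag E Ψ₀) := by
    have h0 : 0 ≤ schattenTwo (sigmaDiag E Ψ₀) := Real.sqrt_nonneg _
    have hk' : (1 : ℝ) ≤ k := by exact_mod_cast hk
    calc _ = ((k : ℝ) ^ 2 * schattenTwo (sigmaDiag E Ψ₀)) * schattenTwo (sigmaDiag E Ψ₀) := by ring
      _ ≤ k * schattenTwo (sigmaDiag E Ψ₀) := by gcongr; linarith
  rw [h3] at h2
  linarith

/-- The error bound is strictly positive, which leaves room for the temporal ensemble at finite
times. -/
lemma error_pos (h₀ : ‖Ψ₀‖ = 1) (hk : 1 ≤ k) :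
    0 < ((D : ℝ) * schattenInf (sigmaDiag E Ψ₀)) ^ k * ((k : ℝ) ^ 2 / (D : ℝ)) +
        (k : ℝ) * schattenTwo (sigmaDiag E Ψ₀) := by
  have := neZero_of_norm_eq_one h₀
  have hD : (0 : ℝ) < D := Nat.cast_pos.2 (NeZero.pos D)
  have hk' : (0 : ℝ) < k := Nat.cast_pos.2 hk
  have h0 : 0 ≤ schattenTwo (sigmaDiag E Ψ₀) := Real.sqrt_nonneg _
  have h1 : 0 < (D : ℝ) * schattenInf (sigmaDiag E Ψ₀) :=
    one_pos.trans_le (one_le_mul_schattenInf E h₀)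
  positivity

lemma tendsto_schattenOne_sub {ι α : Type*} [Fintype ι] [DecidableEq ι] {l : Filter α}
    {A : α → Matrix ι ι ℂ} {B : Matrix ι ι ℂ} (h : Tendsto A l (𝓝 B)) :
    Tendsto (fun t => schattenOne (A t - B)) l (𝓝 0) := by
  refine squeeze_zero (g := fun t => ∑ x, ∑ y, ‖(A t - B) x y‖)
    (fun t => Finset.sum_nonneg fun _ _ => Real.sqrt_nonneg _)
    (fun t => schattenOne_le_sum_norm_entries _) ?_
  have h1 : ∀ x y, Tendsto (fun t => ‖(A t - B) x y‖) l (𝓝 0) := fun x y => by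
    have := tendsto_pi_nhds.1 (tendsto_pi_nhds.1 h x) y
    exact tendsto_iff_norm_sub_tendsto_zero.1 this
  simpa using tendsto_finsetSum Finset.univ fun x _ =>
    tendsto_finsetSum Finset.univ fun y _ => h1 x y

end Distance

end Scrooge

theorem theorem1 :
    (∃ C : ℝ, 0 < C ∧
      ∀ (D k : ℕ), 1 ≤ k →
      ∀ (E : OrthonormalBasis (Fin D) ℂ (Scrooge.Hilb D)) (Ψ₀ : Scrooge.Hilb D), ‖Ψ₀‖ = 1 →
      (k : ℝ) ^ 2 * Scrooge.schattenTwo (Scrooge.sigmaDiag E Ψ₀) ≤ 1 →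
        Scrooge.IsScroogeDesign (Scrooge.sigmaDiag E Ψ₀) k
          (C * (((D : ℝ) * Scrooge.schattenInf (Scrooge.sigmaDiag E Ψ₀)) ^ k
                * ((k : ℝ) ^ 2 / (D : ℝ))
              + (k : ℝ) * Scrooge.schattenTwo (Scrooge.sigmaDiag E Ψ₀)))
          (Scrooge.randomPhase E Ψ₀) ∧
        ∀ (H : Matrix (Fin D) (Fin D) ℂ) (e : Fin D → ℝ),
          Scrooge.IsEigensystem H E e → Scrooge.NoResonance k e →
          ∀ᶠ T : ℝ in Filter.atTop,
            Scrooge.IsScroogeDesign (Scrooge.sigmaDiag E Ψ₀) k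
              (C * (((D : ℝ) * Scrooge.schattenInf (Scrooge.sigmaDiag E Ψ₀)) ^ k
                    * ((k : ℝ) ^ 2 / (D : ℝ))
                  + (k : ℝ) * Scrooge.schattenTwo (Scrooge.sigmaDiag E Ψ₀)))
              (Scrooge.temporal H Ψ₀ T)) ∧
    (∀ (D k : ℕ), 1 ≤ k →
      ∀ (E : OrthonormalBasis (Fin D) ℂ (Scrooge.Hilb D)) (Ψ₀ : Scrooge.Hilb D), ‖Ψ₀‖ = 1 →
      ∀ (H : Matrix (Fin D) (Fin D) ℂ) (e : Fin D → ℝ),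
        Scrooge.IsEigensystem H E e → Scrooge.NoResonance k e →
        Filter.Tendsto (fun T : ℝ => Scrooge.moment k (Scrooge.temporal H Ψ₀ T)) Filter.atTop
          (nhds (Scrooge.moment k (Scrooge.randomPhase E Ψ₀)))) := by
  -- The constant 1 suffices for random phases; 2 absorbs the finite-time error.
  refine ⟨⟨2, two_pos, fun D k hk E Ψ₀ h₀ hs => ?_⟩, fun D k _ E Ψ₀ h₀ H e hH hres =>
    Scrooge.tendsto_moment_temporal h₀ hH hres⟩
  have hε := Scrooge.error_pos E h₀ hk
  have hle := Scrooge.half_schattenOne_le E h₀ hk hs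
  refine ⟨⟨Scrooge.isPureStateEnsemble_randomPhase E h₀, by linarith⟩, fun H e hH hres => ?_⟩
  have hlim := Scrooge.tendsto_schattenOne_sub
    (Scrooge.tendsto_moment_temporal h₀ hH hres)
  filter_upwards [eventually_gt_atTop 0, hlim.eventually (eventually_lt_nhds hε)] with T hT hlt
  refine ⟨Scrooge.isPureStateEnsemble_temporal h₀ hH hT, ?_⟩
  have htri := Scrooge.schattenOne_add_le
    (Scrooge.moment k (Scrooge.temporal H Ψ₀ T) - Scrooge.moment k (Scrooge.randomPhase E Ψ₀))
    (Scrooge.moment k (Scrooge.randomPhase E Ψ₀) -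
      Scrooge.moment k (Scrooge.scrooge (Scrooge.sigmaDiag E Ψ₀)))
  rw [sub_add_sub_cancel] at htri
  linarith
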